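/- Let $q$ be a prime power, $\mathbb F=\mathbb F_{q^2}$, and let $R=\mathbb F[x,y]=\mathbb F[X,Y]/(X^{q+1}-Y^q-Y)$ be the coordinate ring of the affine Hermitian curve, with $\mathbb F$-rational points $P_k=(\alpha_k,\beta_k)$, $1\le k\le n=q^3$. Every $f\in R$ is uniquely $f=\sum_{a\ge 0,\,0\le b<q}f_{a,b}x^ay^b$; for $f\ne0$ put $\rho(f)=\max\{aq+b(q+1): f_{a,b}\ne0\}$. Let $'=d/dx$ be the $\mathbb F$-derivation of $R$ with $x'=1$ and $y'=x^q$. Let $z_0^*=y^{q-1}+1$ and $z_b^*=y^{q-1-b}$ for $0<b<q$. Let $e=(e_1,\dots,e_n)\in\mathbb F^n$ be a nonzero vector; $P_k$ is an error position if $e_k\neq0$. Put $s_{a,b}=\sum_{k}e_k\alpha_k^a\beta_k^b$ for integers $a\ge0$, and $s_{a,b}=0$ for $a<0$. Let $I^e=\{f\in R: f(P_k)=0\text{ whenever }e_k\ne0\}$, $\Delta^e=\rho(R\setminus\{0\})\setminus\rho(I^e\setminus\{0\})$, $\sigma_i=\min\{\rho(f):0\ne f\in I^e,\ \rho(f)\equiv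 i \bmod q\}$ for $0\le i<q$, and $$M=\max_i\sigma_i+\max\{\max\Delta^e,\ q^2-q-1\}.$$ Define $f_i^{(m)},\varphi_i^{(m)},g_i^{(m)},\psi_i^{(m)}\in R$ for $0\le i<q$ and $m\ge 0$ recursively. Initially $f_i^{(0)}=y^i$, $\varphi_i^{(0)}=0$, $g_i^{(0)}=0$, $\psi_i^{(0)}=-z_i^*$. Given the data for $m$, for each $0\le i<q$ let $0\le j<q$ be the index with $i+j\equiv m\bmod q$, and put $d_i=\rho(f_i^{(m)})$, $d_j=\rho(f_j^{(m)})$, $r_i=(m-d_i-j(q+1))/q$, $\tilde f_i=y^jf_i^{(m)}$, $\mu_i=\sum_{c=0}^{q-1}\sum_a(\tilde f_i)_{a,c}\,s_{a+r_i,c}$, $p=(d_i+d_j-m)/q-1$ (the divisions by $q$ are exact), and $$\begin{pmatrix}f_i^{(m+1)}&\varphi_i^{(m+1)}\\ g_j^{(m+1)}&\psi_j^{(m+1)}\end{pmatrix}=U_i^{(m)}\begin{pmatrix}f_i^{(m)}&\varphi_i^{(m)}\\ g_j^{(m)}&\psi_j^{(m)}\end{pmatrix},$$ where $U_i^{(m)}=\begin{pmatrix}1&-\mu_ix^p\\0&1\end{pmatrix}$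 if $\mu_i=0$ or $p\ge0$ (the entry $-\mu_ix^p$ being $0$ when $\mu_i=0$), and $U_i^{(m)}=\begin{pmatrix}x^{-p}&-\mu_i\\1/\mu_i&0\end{pmatrix}$ otherwise. Put $f_i=f_i^{(M+1)}$ and $g_i=g_i^{(M+1)}$. Then for every error position $P_k$, $\sum_{i=0}^{q-1}f_i'(P_k)g_i(P_k)\neq 0$ and $$e_k=\Bigl(\sum_{i=0}^{q-1}f_i'(P_k)\,g_i(P_k)\Bigr)^{-1}.$$ -/

import Mathlib

open Polynomial

namespace Hermitian

noncomputable section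

section Curve

variable (K : Type*) [Field K] (q : ℕ)

/-- The polynomial `Y ^ q + Y - X ^ (q + 1)` in `K[X][Y]`; the outer variable is `Y`. -/
def curvePoly : K[X][X] := X ^ q + X - C (X ^ (q + 1))

theorem curvePoly_monic [hq : Fact (IsPrimePow q)] : (curvePoly K q).Monic := by
  have h1 : 1 < q := hq.out.one_lt
  have : curvePoly K q = X ^ q + (X - C (X ^ (q + 1))) := by
    unfold curvePoly; ring
  rw [this]
  refine monic_X_pow_add ?_
  rw [degree_X_sub_C]
  exact_mod_cast h1

/-- The ring `K[x, y] = K[X, Y] / (X ^ (q + 1) - Y ^ q - Y)`. -/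
abbrev CoordRing : Type _ := AdjoinRoot (curvePoly K q)

/-- The class of `X`. -/
def x : CoordRing K q := AdjoinRoot.of (curvePoly K q) X

/-- The class of `Y`. -/
def y : CoordRing K q := AdjoinRoot.root (curvePoly K q)

/-- The affine `K`-rational points `(α, β)` of the curve. -/
abbrev Point : Type _ := {P : K × K // P.1 ^ (q + 1) = P.2 ^ q + P.2}

variable {K q}

/-- Evaluation of a function at a point, `f ↦ f(P)`. -/
def evalAt (P : Point K q) : CoordRing K q →+* K :=
  AdjoinRoot.lift (evalRingHom P.1.1) P.1.2 (by
    rw [curvePoly, eval₂_sub, eval₂_add, eval₂_X_pow, eval₂_X, eval₂_C]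
    simp [P.2])

/-- The polynomials `f_b(x)` of the unique expansion
`f = f_0(x) + f_1(x) y + ⋯ + f_{q-1}(x) y ^ (q-1)`. -/
def component [Fact (IsPrimePow q)] (f : CoordRing K q) (b : ℕ) : K[X] :=
  (AdjoinRoot.modByMonicHom (curvePoly_monic K q) f).coeff b

/-- The order function: the maximum of `a q + b (q + 1)` over the monomials
`x ^ a y ^ b`, `b < q`, that occur in `f`. It is only meaningful for `f ≠ 0`. -/
def rho [Fact (IsPrimePow q)] (f : CoordRing K q) : ℕ :=
  (Finset.univ : Finset (Fin q)).sup fun b =>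
    (component f b).support.sup fun a => a * q + b * (q + 1)

/-- `∂/∂X + X ^ q ∂/∂Y` on `K[X][Y]`. -/
def ambientDerivation (K : Type*) [Field K] (q : ℕ) : Derivation K K[X][X] K[X][X] :=
  PolynomialModule.equivPolynomialSelf.compDer
      (Derivation.mapCoeffs (derivative' : Derivation K K[X] K[X])) +
    (C (X ^ q) : K[X][X]) •
      (derivative' : Derivation K[X] K[X][X] K[X][X]).restrictScalars K

theorem ambientDerivation_C (c : K[X]) :
    ambientDerivation K q (C c) = C (derivative c) := by
  simp [ambientDerivation]

theorem ambientDerivation_X : ambientDerivation K q X = C (X ^ q) := by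
  simp [ambientDerivation]

theorem ambientDerivation_curvePoly [Fintype K] [Fact (IsPrimePow q)]
    (hK : Fintype.card K = q ^ 2) : ambientDerivation K q (curvePoly K q) = 0 := by
  have h0 : (q : K) = 0 := by
    have h := Nat.cast_card_eq_zero K
    rw [hK] at h
    exact pow_eq_zero_iff (two_ne_zero) |>.1 (by exact_mod_cast h)
  have h1 : (q : K[X]) = 0 := by
    rw [← C_eq_natCast, h0, C_0]
  have h2 : (q : K[X][X]) = 0 := by
    rw [← C_eq_natCast, h1, C_0]
  rw [curvePoly, map_sub, map_add, Derivation.leibniz_pow, ambientDerivation_C,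
    ambientDerivation_X, derivative_X_pow]
  simp [h0, h2]

/-- The quotient map `K[X][Y] → K[x, y]` as a homomorphism of `K`-algebras. -/
def quotientMap (K : Type*) [Field K] (q : ℕ) : K[X][X] →ₐ[K] CoordRing K q :=
  (AdjoinRoot.mkₐ (curvePoly K q)).restrictScalars K

theorem mk_ambientDerivation_eq_zero [Fintype K] [Fact (IsPrimePow q)]
    (hK : Fintype.card K = q ^ 2) (p : K[X][X])
    (hp : quotientMap K q p = 0) :
    quotientMap K q (ambientDerivation K q p) = 0 := by
  obtain ⟨a, rfl⟩ := AdjoinRoot.mk_eq_zero.1 hp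
  rw [Derivation.leibniz, ambientDerivation_curvePoly hK, smul_zero, add_zero]
  exact AdjoinRoot.mk_eq_zero.2 (Dvd.intro _ rfl)

/-- `d/dx`: the `K`-derivation of `K[x, y]` with `dx/dx = 1` and `dy/dx = x ^ q`. -/
def ddx [Fintype K] [Fact (IsPrimePow q)] (hK : Fintype.card K = q ^ 2) :
    Derivation K (CoordRing K q) (CoordRing K q) :=
  Derivation.liftOfSurjective (f := quotientMap K q)
    AdjoinRoot.mk_surjective (mk_ambientDerivation_eq_zero hK)

theorem ddx_x [Fintype K] [Fact (IsPrimePow q)] (hK : Fintype.card K = q ^ 2) :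
    ddx hK (x K q) = 1 := by
  have h := Derivation.liftOfSurjective_apply (f := quotientMap K q)
    AdjoinRoot.mk_surjective (mk_ambientDerivation_eq_zero hK) (C X)
  rw [ambientDerivation_C, derivative_X] at h
  exact h.trans (map_one _)

theorem ddx_y [Fintype K] [Fact (IsPrimePow q)] (hK : Fintype.card K = q ^ 2) :
    ddx hK (y K q) = x K q ^ q := by
  have h := Derivation.liftOfSurjective_apply (f := quotientMap K q)
    AdjoinRoot.mk_surjective (mk_ambientDerivation_eq_zero hK) X
  rw [ambientDerivation_X, C_pow, map_pow] at h
  exact h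

end Curve

section ErrorVector

variable {K : Type*} [Field K] {q : ℕ}

/-- The ideal of all functions that vanish at the error positions of `e`. -/
def errorLocatorIdeal (e : Point K q → K) : Ideal (CoordRing K q) where
  carrier := {f | ∀ P, e P ≠ 0 → evalAt P f = 0}
  zero_mem' := fun P _ => map_zero (evalAt P)
  add_mem' := fun {f g} hf hg P hP => by rw [map_add, hf P hP, hg P hP, add_zero]
  smul_mem' := fun c f hf P hP => by rw [smul_eq_mul, map_mul, hf P hP, mul_zero]

/-- `s_{a,b} = ∑_k e_k α_k ^ a β_k ^ b` for `a ≥ 0`, and `s_{a,b} = 0` for `a < 0`. -/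
def syndrome [Fintype K] [DecidableEq K] (e : Point K q → K) (a : ℤ) (b : ℕ) : K :=
  if 0 ≤ a then ∑ P : Point K q, e P * P.1.1 ^ a.toNat * P.1.2 ^ b else 0

variable [Fact (IsPrimePow q)]

/-- The footprint: the orders of nonzero functions that are not orders of
nonzero elements of the error locator ideal. -/
def footprint (e : Point K q → K) : Set ℕ :=
  {d | ∃ f : CoordRing K q, f ≠ 0 ∧ rho f = d} \
    {d | ∃ f ∈ errorLocatorIdeal e, f ≠ 0 ∧ rho f = d}

/-- `σ_i`, the least order congruent to `i` modulo `q` of a nonzero element of the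
error locator ideal. -/
def sigma (e : Point K q → K) (i : Fin q) : ℕ :=
  sInf {d | d ≡ i [MOD q] ∧ ∃ f ∈ errorLocatorIdeal e, f ≠ 0 ∧ rho f = d}

/-- The last iteration `M = max_i σ_i + max {max Δ, q ^ 2 - q - 1}`, with `Δ` the
footprint. -/
def lastIteration (e : Point K q → K) : ℕ :=
  (Finset.univ : Finset (Fin q)).sup (sigma e) + max (sSup (footprint e)) (q ^ 2 - q - 1)

end ErrorVector

section Algorithm

variable (K : Type*) [Field K] (q : ℕ)

/-- The data `f_i, φ_i, g_i, ψ_i`, `0 ≤ i < q`, held by the algorithm. -/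
structure State where
  f : Fin q → CoordRing K q
  φ : Fin q → CoordRing K q
  g : Fin q → CoordRing K q
  ψ : Fin q → CoordRing K q

/-- The `∗`-basis: `y ^ (q-1) + 1` for `b = 0` and `y ^ (q-1-b)` for `0 < b < q`. -/
def zstar (b : Fin q) : CoordRing K q :=
  if (b : ℕ) = 0 then y K q ^ (q - 1) + 1 else y K q ^ (q - 1 - b)

/-- The initial data `f_i = y ^ i`, `φ_i = 0`, `g_i = 0`, `ψ_i = - z_i^∗`. -/
def initialState : State K q where
  f := fun i => y K q ^ (i : ℕ)
  φ := fun _ => 0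
  g := fun _ => 0
  ψ := fun i => -zstar K q i

variable {K q}

/-- The index `j` with `0 ≤ j < q` and `i + j ≡ m` modulo `q`. -/
def partner (m : ℕ) (i : Fin q) : Fin q :=
  ⟨(m + (q - i)) % q, Nat.mod_lt _ i.pos⟩

variable [Fact (IsPrimePow q)]

/-- `r_i = (m - d_i - j (q + 1)) / q`; for the data produced by the algorithm the
division is exact. -/
def shift (m : ℕ) (s : State K q) (i : Fin q) : ℤ :=
  ((m : ℤ) - rho (s.f i) - (partner m i : ℕ) * (q + 1)) / q

/-- `p = (d_i + d_j - m) / q - 1`; for the data produced by the algorithm the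
division is exact. -/
def gap (m : ℕ) (s : State K q) (i : Fin q) : ℤ :=
  ((rho (s.f i) : ℤ) + rho (s.f (partner m i)) - m) / q - 1

variable [Fintype K] [DecidableEq K]

/-- `μ_i = ∑_c ∑_a (y ^ j f_i)_{a,c} s_{a + r_i, c}`. -/
def discrepancy (e : Point K q → K) (m : ℕ) (s : State K q) (i : Fin q) : K :=
  ∑ c : Fin q, (component (y K q ^ (partner m i : ℕ) * s.f i) c).sum
    fun a t => t * syndrome e (a + shift m s i) c

/-- The update matrix `U_i`. -/
def updateMatrix (e : Point K q → K) (m : ℕ) (s : State K q) (i : Fin q) :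
    Matrix (Fin 2) (Fin 2) (CoordRing K q) :=
  let μ := discrepancy e m s i
  let p := gap m s i
  if μ = 0 ∨ 0 ≤ p then
    !![1, -(algebraMap K (CoordRing K q) μ * x K q ^ p.toNat); 0, 1]
  else
    !![x K q ^ (-p).toNat, -algebraMap K (CoordRing K q) μ;
      algebraMap K (CoordRing K q) μ⁻¹, 0]

/-- The product of `U_i` with the matrix with rows `(f_i, φ_i)` and `(g_j, ψ_j)`,
where `i + j ≡ m` modulo `q`. -/
def updatedBlock (e : Point K q → K) (m : ℕ) (s : State K q) (i : Fin q) :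
    Matrix (Fin 2) (Fin 2) (CoordRing K q) :=
  updateMatrix e m s i *
    !![s.f i, s.φ i; s.g (partner m i), s.ψ (partner m i)]

/-- Iteration `m`: the rows of the `i`-th updated block are the new `(f_i, φ_i)` and the
new `(g_j, ψ_j)`. Since `j ↦ i` is again `partner m`, the new `(g_i, ψ_i)` stands in the
second row of the block with index `partner m i`. -/
def step (e : Point K q → K) (m : ℕ) (s : State K q) : State K q where
  f := fun i => updatedBlock e m s i 0 0
  φ := fun i => updatedBlock e m s i 0 1
  g := fun i => updatedBlock e m s (partner m i) 1 0
  ψ := fun i => updatedBlock e m s (partner m i) 1 1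

/-- The data with superscript `(m)`, before iteration `m`. -/
def stateAt (e : Point K q → K) : ℕ → State K q
  | 0 => initialState K q
  | m + 1 => step e m (stateAt e m)

/-- The output of the algorithm, after the iterations `0, …, M`. -/
def finalState (e : Point K q → K) : State K q :=
  stateAt e (lastIteration e + 1)

end Algorithm

end

end Hermitian

/-!
The syndromes are the coefficients of the series `S = ∑ s_{a,c} x ^ (-a - 1) z_c^∗`, which is the
sum over the points `P = (α, β)` of `e_P / (x - α)` times a function that is `1` at `P` and `0` at
the other points above `α`. A function `f` lies in the error locator ideal iff the polar part of
`f S` is the whole of `f S`, that is, `f S = φ` for some `φ` in the ring. In that case, multiplying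
by `x ^ |K| - x` and differentiating gives `φ(P) = e_P f'(P)` at every error position `P`.

The algorithm maintains pairs `(f_i, φ_i)` for which `f_i S - φ_i` has small order. The traces of
`φ_i g_k - f_i ψ_k`, `φ_i f_k - f_i φ_k` and `ψ_i g_k - g_i ψ_k` are those of a symplectic basis.
This forces the discrepancies of partners `i` and `j` to agree, hence `U_i = U_j`, and since
`det U_i = 1` each iteration preserves both the symplectic relations and the identity
`∑ (φ_i g_i - f_i ψ_i) = 1`. When the algorithm stops, every `f_i` is in the error locator ideal
and `f_i S = φ_i` holds exactly, so evaluating this identity at an error position `P` yields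
`e_P ∑ f_i'(P) g_i(P) = 1`.
-/

namespace Hermitian

noncomputable section

section AlternatingForms

variable {A V ι : Type*} [CommRing A] [AddCommGroup V] [Module A V]

/-- The families `v` and `w` behave like the two halves of a symplectic basis for the
bilinear form `B`. -/
structure IsSymplectic [DecidableEq ι] (B : V →ₗ[A] V →ₗ[A] A) (v w : ι → V) : Prop where
  left_left (i k : ι) : B (v i) (v k) = 0
  right_right (i k : ι) : B (w i) (w k) = 0
  left_right (i k : ι) : B (v i) (w k) = if i = k then 1 else 0

/-- First half of the family obtained by letting the matrix `U i` act on the pair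
`(v i, w (σ i))`. -/
def blockLeft (U : ι → Matrix (Fin 2) (Fin 2) A) (σ : ι → ι) (v w : ι → V) (i : ι) : V :=
  U i 0 0 • v i + U i 0 1 • w (σ i)

/-- Second half of the family obtained by letting the matrix `U i` act on the pair
`(v i, w (σ i))`. It is indexed so that the new vector replacing `w (σ i)` has index `σ i`;
this uses that `σ` is an involution and that `U (σ i) = U i`. -/
def blockRight (U : ι → Matrix (Fin 2) (Fin 2) A) (σ : ι → ι) (v w : ι → V) (i : ι) : V :=
  U i 1 0 • v (σ i) + U i 1 1 • w i

variable {U : ι → Matrix (Fin 2) (Fin 2) A} {σ : ι → ι} {v w : ι → V}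

theorem IsSymplectic.block [DecidableEq ι] {B : V →ₗ[A] V →ₗ[A] A} (h : IsSymplectic B v w)
    (hB : B.IsAlt) (hσ : σ.Involutive) (hU : ∀ i, U (σ i) = U i) (hdet : ∀ i, (U i).det = 1) :
    IsSymplectic B (blockLeft U σ v w) (blockRight U σ v w) := by
  have right_left (i k : ι) : B (w i) (v k) = if i = k then -1 else 0 := by
    rw [← hB.neg, h.left_right]
    simp only [eq_comm (a := k), neg_ite, neg_zero]
  refine ⟨fun i k => ?_, fun i k => ?_, fun i k => ?_⟩ <;>
    simp only [blockLeft, blockRight, map_add, map_smul, LinearMap.add_apply,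
      LinearMap.smul_apply, smul_eq_mul, h.left_left, h.right_right, h.left_right, right_left,
      ← hσ.eq_iff (x := i), hσ.injective.eq_iff]
  · split_ifs with hik
    · rw [← hik, hU]; ring
    · ring
  · split_ifs with hik
    · rw [← hik, hU]; ring
    · ring
  · split_ifs with hik
    · subst hik
      linear_combination (Matrix.det_fin_two (U i)).symm.trans (hdet i)
    · ring

theorem sum_block {W : Type*} [AddCommGroup W] [Module A W] [Fintype ι]
    {B : V →ₗ[A] V →ₗ[A] W} (hB : B.IsAlt) (hσ : σ.Involutive) (hU : ∀ i, U (σ i) = U i)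
    (hdet : ∀ i, (U i).det = 1) :
    ∑ i, B (blockLeft U σ v w i) (blockRight U σ v w i) = ∑ i, B (v i) (w i) := by
  have cancel (u : ι → V) (t : ι → A) (ht : ∀ i, t (σ i) = t i) :
      ∑ i, t i • B (u i) (u (σ i)) = 0 := by
    refine Finset.sum_involution (fun i _ => σ i) (fun i _ => ?_) (fun i _ hi hfix => hi ?_)
      (fun _ _ => Finset.mem_univ _) (fun i _ => hσ i)
    · rw [ht, hσ, ← hB.neg, smul_neg, neg_add_cancel]
    · rw [hfix, hB, smul_zero]
  have expand (i : ι) : B (blockLeft U σ v w i) (blockRight U σ v w i) =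
      (U i 0 0 * U i 1 0) • B (v i) (v (σ i)) - (U i 0 1 * U i 1 1) • B (w i) (w (σ i)) +
        ((U i 0 0 * U i 1 1) • B (v i) (w i) -
          (U (σ i) 0 1 * U (σ i) 1 0) • B (v (σ i)) (w (σ i))) := by
    simp only [blockLeft, blockRight, map_add, map_smul, LinearMap.add_apply,
      LinearMap.smul_apply, hU, ← hB.neg (w i) (w (σ i)), ← hB.neg (v (σ i)) (w (σ i))]
    module
  simp only [expand, Finset.sum_add_distrib, Finset.sum_sub_distrib]
  rw [cancel v _ fun i => by rw [hU], cancel w _ fun i => by rw [hU],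
    hσ.bijective.sum_comp fun i => (U i 0 1 * U i 1 0) • B (v i) (w i),
    ← Finset.sum_sub_distrib, sub_zero, zero_add]
  refine Finset.sum_congr rfl fun i _ => ?_
  rw [← sub_smul, ← Matrix.det_fin_two, hdet, one_smul]

/-- The `A`-bilinear form `((f, φ), (g, ψ)) ↦ φ g - f ψ`, minus the determinant, on pairs of
elements of an `A`-algebra. The sign makes the initial data of the algorithm symplectic. -/
def pairForm (A R : Type*) [CommRing A] [CommRing R] [Algebra A R] :
    R × R →ₗ[A] R × R →ₗ[A] R :=
  LinearMap.mk₂ A (fun u v => u.2 * v.1 - u.1 * v.2)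
    (fun _ _ _ => by simp only [Prod.fst_add, Prod.snd_add]; ring)
    (fun _ _ _ => by
      simp only [Prod.smul_fst, Prod.smul_snd, smul_mul_assoc, smul_sub])
    (fun _ _ _ => by simp only [Prod.fst_add, Prod.snd_add]; ring)
    (fun _ _ _ => by
      simp only [Prod.smul_fst, Prod.smul_snd, mul_smul_comm, smul_sub])

theorem pairForm_apply {R : Type*} [CommRing R] [Algebra A R] (u v : R × R) :
    pairForm A R u v = u.2 * v.1 - u.1 * v.2 := rfl

theorem pairForm_isAlt {R : Type*} [CommRing R] [Algebra A R] : (pairForm A R).IsAlt :=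
  fun u => by rw [pairForm_apply, mul_comm, sub_self]

end AlternatingForms

section SequencePairing

variable {A : Type*} [CommRing A]

/-- The functional `∑ p_a X ^ a ↦ ∑ p_a s_{a + r}`. Its value at `p` is the coefficient of
`X ^ (-r - 1)` in the product of `p` with the series `∑ s_n X ^ (-n - 1)`. -/
def seqPairing (s : ℤ → A) (r : ℤ) : A[X] →ₗ[A] A :=
  Polynomial.lsum fun a => s (a + r) • LinearMap.id

theorem seqPairing_apply (s : ℤ → A) (r : ℤ) (p : A[X]) :
    seqPairing s r p = p.sum fun a t => t * s (a + r) := by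
  simp only [seqPairing, lsum_apply, LinearMap.smul_apply, LinearMap.id_apply, smul_eq_mul,
    mul_comm]

theorem seqPairing_monomial (s : ℤ → A) (r : ℤ) (a : ℕ) (t : A) :
    seqPairing s r (monomial a t) = t * s (a + r) := by
  rw [seqPairing_apply]
  exact sum_monomial_index t _ (zero_mul _)

theorem seqPairing_X_pow_mul (s : ℤ → A) (r : ℤ) (n : ℕ) (p : A[X]) :
    seqPairing s r (X ^ n * p) = seqPairing s (r + n) p := by
  induction p using Polynomial.induction_on' with
  | add p₁ p₂ h₁ h₂ => rw [mul_add, map_add, map_add, h₁, h₂]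
  | monomial a t =>
    rw [X_pow_mul_monomial, seqPairing_monomial, seqPairing_monomial]
    congr 2
    push_cast
    ring

/-- The sequence `1, α, α ^ 2, …`, extended by zero to negative indices. Its series
`∑ s_n X ^ (-n - 1)` is `1 / (X - α)`. -/
def geomSeq (α : A) (n : ℤ) : A := if 0 ≤ n then α ^ n.toNat else 0

/-- The sequence concentrated in the index `-1`. Its series `∑ s_n X ^ (-n - 1)` is `1`. -/
def deltaSeq (A : Type*) [CommRing A] (n : ℤ) : A := if n = -1 then 1 else 0

theorem geomSeq_add_one (α : A) (n : ℤ) :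
    geomSeq α (n + 1) = α * geomSeq α n + deltaSeq A n := by
  unfold geomSeq deltaSeq
  rcases lt_trichotomy n (-1) with h | rfl | h
  · rw [if_neg (by omega), if_neg (by omega), if_neg (by omega), mul_zero, add_zero]
  · simp
  · rw [if_pos (by omega), if_pos (by omega), if_neg (by omega),
      show (n + 1).toNat = n.toNat + 1 by omega, pow_succ', add_zero]

theorem seqPairing_deltaSeq (r : ℤ) (p : A[X]) :
    seqPairing (deltaSeq A) r p = if r < 0 then p.coeff (-r - 1).toNat else 0 := by
  induction p using Polynomial.induction_on' with
  | add p₁ p₂ h₁ h₂ => rw [map_add, h₁, h₂, coeff_add, ite_add_ite, add_zero]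
  | monomial n a =>
    rw [seqPairing_monomial, coeff_monomial, deltaSeq]
    split_ifs <;> first | omega | simp

theorem seqPairing_geomSeq_X_sub_C_mul (α : A) (r : ℤ) (p : A[X]) :
    seqPairing (geomSeq α) r ((X - C α) * p) = seqPairing (deltaSeq A) r p := by
  induction p using Polynomial.induction_on' with
  | add p₁ p₂ h₁ h₂ => rw [mul_add, map_add, map_add, h₁, h₂]
  | monomial n a =>
    rw [sub_mul, map_sub, X_mul_monomial, C_mul_monomial, seqPairing_monomial,
      seqPairing_monomial, seqPairing_monomial, Nat.cast_add_one, add_right_comm,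
      geomSeq_add_one]
    ring

theorem seqPairing_geomSeq_of_nonneg (α : A) {r : ℤ} (hr : 0 ≤ r) (p : A[X]) :
    seqPairing (geomSeq α) r p = α ^ r.toNat * p.eval α := by
  induction p using Polynomial.induction_on' with
  | add p₁ p₂ h₁ h₂ => rw [map_add, h₁, h₂, eval_add, mul_add]
  | monomial n a =>
    rw [seqPairing_monomial, eval_monomial, geomSeq, if_pos (by omega),
      show ((n : ℤ) + r).toNat = n + r.toNat by omega, pow_add]
    ring

end SequencePairing

section Basis

variable {K : Type*} [Field K] {q : ℕ}

theorem smul_eq_C_smul {V : Type*} [SMul K V] [MulAction K[X] V]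
    [IsScalarTower K K[X] V] (u : K) (v : V) : u • v = (C u : K[X]) • v := by
  rw [← smul_one_smul K[X] u v, smul_eq_C_mul, mul_one]

theorem x_pow_mul (n : ℕ) (f : CoordRing K q) :
    x K q ^ n * f = (X ^ n : K[X]) • f := by
  rw [Algebra.smul_def, map_pow]
  rfl

theorem y_pow_q : y K q ^ q = x K q ^ (q + 1) - y K q := by
  have hxy : y K q ^ q + y K q - x K q ^ (q + 1) =
      AdjoinRoot.mk (curvePoly K q) (curvePoly K q) := by
    conv_rhs => enter [2]; unfold curvePoly
    rw [map_sub, map_add, map_pow, C_pow, map_pow]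
    rfl
  linear_combination hxy.trans AdjoinRoot.mk_self

variable [Fact (IsPrimePow q)]

theorem one_lt_q : 1 < q := (Fact.out : IsPrimePow q).one_lt

theorem natDegree_curvePoly : (curvePoly K q).natDegree = q := by
  rw [curvePoly, add_sub_assoc, natDegree_add_eq_left_of_natDegree_lt, natDegree_X_pow]
  rw [natDegree_X_sub_C, natDegree_X_pow]
  exact one_lt_q

/-- The basis `1, y, …, y ^ (q - 1)` of the coordinate ring over `K[X]`. -/
def yBasis : Module.Basis (Fin q) K[X] (CoordRing K q) :=
  (AdjoinRoot.powerBasisAux' (curvePoly_monic K q)).reindex (finCongr natDegree_curvePoly)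

theorem yBasis_repr (f : CoordRing K q) (c : Fin q) : yBasis.repr f c = component f c := rfl

theorem yBasis_apply (c : Fin q) : yBasis c = y K q ^ (c : ℕ) := by
  rw [yBasis, Module.Basis.reindex_apply]
  exact (AdjoinRoot.powerBasis' (curvePoly_monic K q)).basis_eq_pow _

theorem eq_sum_component (f : CoordRing K q) :
    f = ∑ c : Fin q, component f c • y K q ^ (c : ℕ) := by
  simpa only [yBasis_repr, yBasis_apply] using (yBasis.sum_repr f).symm

theorem ext_component {f g : CoordRing K q}
    (h : ∀ c : Fin q, component f c = component g c) : f = g :=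
  yBasis.ext_elem h

theorem hom_ext {V : Type*} [AddCommGroup V] [Module K[X] V] {φ ψ : CoordRing K q →ₗ[K[X]] V}
    (h : ∀ c : Fin q, φ (y K q ^ (c : ℕ)) = ψ (y K q ^ (c : ℕ))) : φ = ψ :=
  yBasis.ext fun c => by rw [yBasis_apply, h]

/-- The `b`-th component as a `K[X]`-linear map. -/
def componentHom (b : ℕ) : CoordRing K q →ₗ[K[X]] K[X] :=
  (lcoeff K[X] b).comp (AdjoinRoot.modByMonicHom (curvePoly_monic K q))

theorem componentHom_apply (f : CoordRing K q) (b : ℕ) : componentHom b f = component f b := rfl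

theorem component_smul (p : K[X]) (f : CoordRing K q) (b : ℕ) :
    component (p • f) b = p * component f b :=
  map_smul (componentHom b) p f

theorem component_y_pow (b c : Fin q) :
    component (y K q ^ (c : ℕ)) b = if b = c then 1 else 0 := by
  rw [← yBasis_apply, ← yBasis_repr, Module.Basis.repr_self, Finsupp.single_apply]
  simp only [eq_comm]

/-- The last component. It is a dualizing form: `1, y, …, y ^ (q - 1)` and the `∗`-basis
are dual to each other with respect to `(f, g) ↦ trace (f g)`. -/
def trace : CoordRing K q →ₗ[K[X]] K[X] := componentHom (q - 1)

theorem trace_y_pow_of_lt {n : ℕ} (hn : n < q) :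
    trace (y K q ^ n) = if n = q - 1 then 1 else 0 := by
  refine (component_y_pow ⟨q - 1, Nat.sub_one_lt_of_lt hn⟩ ⟨n, hn⟩).trans ?_
  simp only [Fin.ext_iff, eq_comm]

theorem trace_y_pow {n : ℕ} (hn : n < 2 * q - 1) :
    trace (y K q ^ n) = if n = q - 1 then 1 else if n = 2 * q - 2 then -1 else 0 := by
  have hq := one_lt_q (q := q)
  rcases lt_or_ge n q with hnq | hnq
  · rw [trace_y_pow_of_lt hnq, if_neg (c := n = 2 * q - 2) (by omega)]
  · obtain ⟨k, rfl⟩ := Nat.exists_eq_add_of_le hnq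
    have reduce : y K q ^ (q + k) = (X ^ (q + 1) : K[X]) • y K q ^ k - y K q ^ (k + 1) := by
      rw [← x_pow_mul, pow_add, y_pow_q]
      ring
    rw [reduce, map_sub, map_smul, trace_y_pow_of_lt (by omega), trace_y_pow_of_lt (by omega),
      if_neg (by omega), smul_zero, zero_sub, if_neg (c := q + k = q - 1) (by omega), neg_ite,
      neg_zero]
    exact if_congr (by omega) rfl rfl

theorem trace_y_pow_mul_zstar (b c : Fin q) :
    trace (y K q ^ (b : ℕ) * zstar K q c) = if b = c then 1 else 0 := by
  have hq := one_lt_q (q := q)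
  have hb := b.2
  have hc := c.2
  simp only [zstar, Fin.ext_iff]
  by_cases hc0 : (c : ℕ) = 0
  · rw [if_pos hc0, mul_add, mul_one, ← pow_add, map_add, trace_y_pow (by omega),
      trace_y_pow (by omega)]
    split_ifs <;> first | omega | simp only [add_zero, neg_add_cancel]
  · rw [if_neg hc0, ← pow_add, trace_y_pow (by omega)]
    split_ifs <;> first | omega | rfl

theorem trace_mul_zstar (f : CoordRing K q) (c : Fin q) :
    trace (f * zstar K q c) = component f c := by
  have hom_eq : trace.comp (LinearMap.mulRight K[X] (zstar K q c)) = componentHom (c : ℕ) := by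
    refine hom_ext fun b => ?_
    rw [LinearMap.comp_apply, LinearMap.mulRight_apply, trace_y_pow_mul_zstar,
      componentHom_apply, component_y_pow]
    simp only [eq_comm]
  exact LinearMap.congr_fun hom_eq f

theorem eq_zero_of_trace {f : CoordRing K q}
    (h : ∀ c : Fin q, trace (y K q ^ (c : ℕ) * f) = 0) : f = 0 := by
  have hom_eq : trace.comp (LinearMap.mulRight K[X] f) = 0 := hom_ext h
  refine ext_component fun c => ?_
  rw [← trace_mul_zstar, mul_comm, ← componentHom_apply, map_zero]
  exact LinearMap.congr_fun hom_eq (zstar K q c)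

end Basis

section Weight

/-- The order `r q + c (q + 1)` of the monomial `x ^ r y ^ c`. Negative `r` are allowed, so
that it also grades the coefficients of series in `x⁻¹`. -/
def weight (q : ℕ) (r : ℤ) (c : ℕ) : ℤ := r * q + c * (q + 1)

theorem weight_add (q : ℕ) (r n : ℤ) (c : ℕ) : weight q (r + n) c = weight q r c + n * q := by
  unfold weight
  ring

theorem weight_natCast_nonneg (q a c : ℕ) : 0 ≤ weight q a c := by
  unfold weight
  positivity

theorem weight_inj {q : ℕ} {r r' : ℤ} {c c' : Fin q} :
    weight q r c = weight q r' c' ↔ r = r' ∧ c = c' := by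
  refine ⟨fun h => ?_, by rintro ⟨rfl, rfl⟩; rfl⟩
  have hq : (0 : ℤ) < q := by exact_mod_cast c.pos
  unfold weight at h
  have mod_eq : (((c : ℕ) : ℤ) + (r + (c : ℕ)) * q) % q =
      (((c' : ℕ) : ℤ) + (r' + (c' : ℕ)) * q) % q := by
    congr 1
    linarith
  rw [Int.add_mul_emod_self_right, Int.add_mul_emod_self_right,
    Int.emod_eq_of_lt (by positivity) (by exact_mod_cast c.2),
    Int.emod_eq_of_lt (by positivity) (by exact_mod_cast c'.2)] at mod_eq
  rw [mod_eq] at h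
  exact ⟨mul_right_cancel₀ hq.ne' (add_right_cancel h), Fin.ext (by exact_mod_cast mod_eq)⟩

theorem weight_lt_weight {q : ℕ} {r r' : ℤ} {c : Fin q} :
    weight q r c < weight q r' c ↔ r < r' := by
  have hq : (0 : ℤ) < q := by exact_mod_cast c.pos
  unfold weight
  rw [add_lt_add_iff_right, mul_lt_mul_iff_left₀ hq]

theorem weight_le_of_neg {q : ℕ} {r : ℤ} (hr : r < 0) (c : Fin q) :
    weight q r c ≤ q ^ 2 - q - 1 := by
  have hc : ((c : ℕ) : ℤ) ≤ q - 1 := by have := c.2; omega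
  unfold weight
  nlinarith

end Weight

section Order

variable {K : Type*} [Field K] {q : ℕ}

/-- The `K`-subspace of the functions all of whose monomials have order less than `n`. -/
def orderLT (K : Type*) [Field K] (q : ℕ) (n : ℤ) : Submodule K (CoordRing K q) :=
  Submodule.span K
    {f | ∃ (a : ℕ) (c : Fin q), weight q a c < n ∧ f = (X ^ a : K[X]) • y K q ^ (c : ℕ)}

theorem X_pow_smul_y_pow_mem_orderLT {n : ℤ} {a : ℕ} {c : Fin q} (h : weight q a c < n) :
    (X ^ a : K[X]) • y K q ^ (c : ℕ) ∈ orderLT K q n :=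
  Submodule.subset_span ⟨a, c, h, rfl⟩

theorem map_eq_zero_of_mem_orderLT {V : Type*} [AddCommGroup V] [Module K V] {n : ℤ}
    {L : CoordRing K q →ₗ[K] V}
    (hL : ∀ (a : ℕ) (c : Fin q), weight q a c < n → L ((X ^ a : K[X]) • y K q ^ (c : ℕ)) = 0)
    {f : CoordRing K q} (hf : f ∈ orderLT K q n) : L f = 0 := by
  have le_ker : orderLT K q n ≤ LinearMap.ker L := by
    refine Submodule.span_le.2 ?_
    rintro _ ⟨a, c, hac, rfl⟩
    exact hL a c hac
  exact le_ker hf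

theorem orderLT_mono {m n : ℤ} (h : m ≤ n) : orderLT K q m ≤ orderLT K q n :=
  Submodule.span_mono fun _ ⟨a, c, hac, hf⟩ => ⟨a, c, hac.trans_le h, hf⟩

theorem X_pow_smul_mem_orderLT {f : CoordRing K q} {m n : ℤ} (k : ℕ)
    (hf : f ∈ orderLT K q m) (h : m + k * q ≤ n) : (X ^ k : K[X]) • f ∈ orderLT K q n := by
  refine orderLT_mono h ?_
  rw [← Submodule.Quotient.mk_eq_zero]
  refine map_eq_zero_of_mem_orderLT (L := (Submodule.mkQ _).comp
    ((LinearMap.lsmul K[X] (CoordRing K q) (X ^ k)).restrictScalars K)) (fun a c hac => ?_) hf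
  refine (Submodule.Quotient.mk_eq_zero _).2 ?_
  change (X ^ k : K[X]) • (X ^ a : K[X]) • y K q ^ (c : ℕ) ∈ _
  rw [smul_smul, ← pow_add, add_comm k]
  refine X_pow_smul_y_pow_mem_orderLT ?_
  rw [Nat.cast_add, weight_add]
  linarith

/-- The monomial `x ^ k y ^ i` occurs in `f` with coefficient `1`, and all other monomials of
`f` have smaller order. -/
def HasMonicLead (f : CoordRing K q) (k : ℕ) (i : Fin q) : Prop :=
  f - (X ^ k : K[X]) • y K q ^ (i : ℕ) ∈ orderLT K q (weight q k i)

theorem hasMonicLead_y_pow (i : Fin q) : HasMonicLead (y K q ^ (i : ℕ)) 0 i := by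
  rw [HasMonicLead, pow_zero, one_smul, sub_self]
  exact zero_mem _

namespace HasMonicLead

variable {f g : CoordRing K q} {k : ℕ} {i : Fin q}

theorem mem_orderLT (h : HasMonicLead f k i) {n : ℤ} (hn : weight q k i < n) :
    f ∈ orderLT K q n := by
  rw [← sub_add_cancel f ((X ^ k : K[X]) • y K q ^ (i : ℕ))]
  exact add_mem (orderLT_mono hn.le h) (X_pow_smul_y_pow_mem_orderLT hn)

theorem sub (h : HasMonicLead f k i) (hg : g ∈ orderLT K q (weight q k i)) :
    HasMonicLead (f - g) k i := by
  rw [HasMonicLead, sub_right_comm]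
  exact sub_mem h hg

theorem X_pow_smul (h : HasMonicLead f k i) (n : ℕ) :
    HasMonicLead ((X ^ n : K[X]) • f) (k + n) i := by
  rw [HasMonicLead, pow_add, mul_comm (X ^ k), mul_smul, ← smul_sub]
  refine X_pow_smul_mem_orderLT n h ?_
  rw [Nat.cast_add, weight_add]

end HasMonicLead

variable [Fact (IsPrimePow q)]

theorem coeff_component_X_pow_smul_y_pow (a b : ℕ) (c d : Fin q) :
    (component ((X ^ b : K[X]) • y K q ^ (d : ℕ)) c).coeff a = if a = b ∧ c = d then 1 else 0 := by
  rw [component_smul, component_y_pow, mul_ite, mul_one, mul_zero, ite_and]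
  split_ifs <;> simp_all [coeff_X_pow]

theorem mem_orderLT_iff {f : CoordRing K q} {n : ℤ} :
    f ∈ orderLT K q n ↔
      ∀ (a : ℕ) (c : Fin q), n ≤ weight q a c → (component f c).coeff a = 0 := by
  refine ⟨fun hf a c hac => ?_, fun h => ?_⟩
  · refine map_eq_zero_of_mem_orderLT
      (L := (lcoeff K a).comp ((componentHom (c : ℕ)).restrictScalars K)) (fun b d hbd => ?_) hf
    refine (coeff_component_X_pow_smul_y_pow a b c d).trans (if_neg ?_)
    rintro ⟨rfl, rfl⟩
    exact hbd.not_ge hac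
  · rw [eq_sum_component f]
    refine sum_mem fun c _ => ?_
    rw [as_sum_support_C_mul_X_pow (component f c), Finset.sum_smul]
    refine sum_mem fun a ha => ?_
    rw [mul_smul, ← smul_eq_C_smul]
    refine Submodule.smul_mem _ _ (X_pow_smul_y_pow_mem_orderLT ?_)
    contrapose! ha
    exact notMem_support_iff.2 (h a c ha)

theorem eq_zero_of_mem_orderLT {f : CoordRing K q} {n : ℤ} (hn : n ≤ 0)
    (hf : f ∈ orderLT K q n) : f = 0 := by
  refine ext_component fun c => ext fun a => ?_
  rw [mem_orderLT_iff.1 hf a c (hn.trans (weight_natCast_nonneg q a c)), ← componentHom_apply,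
    map_zero, coeff_zero]

theorem rho_le_iff {f : CoordRing K q} {n : ℕ} : rho f ≤ n ↔ f ∈ orderLT K q (n + 1) := by
  simp only [rho, Finset.sup_le_iff, Finset.mem_univ, true_imp_iff, mem_support_iff,
    mem_orderLT_iff, weight]
  refine ⟨fun h a c hac => ?_, fun h c a hac => ?_⟩
  · by_contra hne
    have := h c a hne
    zify at this
    linarith
  · by_contra! hlt
    refine hac (h a c ?_)
    exact_mod_cast hlt

theorem mem_orderLT_rho_add_one (f : CoordRing K q) : f ∈ orderLT K q (rho f + 1) :=
  rho_le_iff.1 le_rfl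

theorem rho_lt_of_mem_orderLT {f : CoordRing K q} (hf : f ≠ 0) {n : ℤ}
    (h : f ∈ orderLT K q n) : (rho f : ℤ) < n := by
  rcases le_or_gt n 0 with hn | hn
  · exact absurd (eq_zero_of_mem_orderLT hn h) hf
  · have : rho f ≤ (n - 1).toNat := by
      rw [rho_le_iff, Int.toNat_of_nonneg (by omega), sub_add_cancel]
      exact h
    omega

namespace HasMonicLead

variable {f : CoordRing K q} {k : ℕ} {i : Fin q}

theorem notMem_orderLT (h : HasMonicLead f k i) : f ∉ orderLT K q (weight q k i) := by
  intro hf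
  have coeff_eq := mem_orderLT_iff.1 (sub_mem hf h) k i le_rfl
  rw [sub_sub_cancel, coeff_component_X_pow_smul_y_pow, if_pos ⟨rfl, rfl⟩] at coeff_eq
  exact one_ne_zero coeff_eq

theorem ne_zero (h : HasMonicLead f k i) : f ≠ 0 := by
  rintro rfl
  exact h.notMem_orderLT (zero_mem _)

theorem rho_eq (h : HasMonicLead f k i) : (rho f : ℤ) = weight q k i := by
  refine le_antisymm ?_ ?_
  · exact Int.lt_add_one_iff.1 (rho_lt_of_mem_orderLT h.ne_zero (h.mem_orderLT (lt_add_one _)))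
  · by_contra! hlt
    exact h.notMem_orderLT (orderLT_mono hlt (mem_orderLT_rho_add_one f))

end HasMonicLead

theorem exists_hasMonicLead_smul {f : CoordRing K q} (hf : f ≠ 0) :
    ∃ (u : K) (k : ℕ) (i : Fin q),
      u ≠ 0 ∧ (rho f : ℤ) = weight q k i ∧ HasMonicLead (u • f) k i := by
  have notMem : f ∉ orderLT K q (rho f) := fun h => (rho_lt_of_mem_orderLT hf h).false
  rw [mem_orderLT_iff] at notMem
  push Not at notMem
  obtain ⟨k, i, hki, hcoeff⟩ := notMem
  have rho_eq : (rho f : ℤ) = weight q k i := by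
    refine hki.antisymm (le_of_not_gt fun hlt => hcoeff ?_)
    exact mem_orderLT_iff.1 (mem_orderLT_rho_add_one f) k i hlt
  refine ⟨((component f i).coeff k)⁻¹, k, i, inv_ne_zero hcoeff, rho_eq, ?_⟩
  refine mem_orderLT_iff.2 fun a c hac => ?_
  rw [← componentHom_apply, map_sub, componentHom_apply, componentHom_apply, coeff_sub,
    coeff_component_X_pow_smul_y_pow, smul_eq_C_smul, component_smul, coeff_C_mul]
  split_ifs with hlead
  · rw [hlead.1, hlead.2, inv_mul_cancel₀ hcoeff, sub_self]
  · have hlt : weight q k i < weight q a c := by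
      refine hac.lt_of_ne fun heq => hlead ?_
      obtain ⟨hka, hic⟩ := weight_inj.1 heq
      exact ⟨by exact_mod_cast hka.symm, hic.symm⟩
    rw [mem_orderLT_iff.1 (mem_orderLT_rho_add_one f) a c (by omega), mul_zero, sub_zero]

theorem exists_sub_smul_mem_orderLT {f g : CoordRing K q} (hf : f ≠ 0) (hg : g ≠ 0)
    (h : rho f = rho g) : ∃ u : K, f - u • g ∈ orderLT K q (rho f) := by
  obtain ⟨u, k, i, hu, hf_rho, hf_lead⟩ := exists_hasMonicLead_smul hf
  obtain ⟨v, k', i', -, hg_rho, hg_lead⟩ := exists_hasMonicLead_smul hg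
  obtain ⟨hk, rfl⟩ := weight_inj.1 (hf_rho.symm.trans ((congrArg _ h).trans hg_rho))
  obtain rfl : k = k' := by exact_mod_cast hk
  refine ⟨u⁻¹ * v, ?_⟩
  rw [hf_rho, ← inv_smul_smul₀ hu f, mul_smul, ← smul_sub,
    ← sub_sub_sub_cancel_right _ _ ((X ^ k : K[X]) • y K q ^ (i : ℕ))]
  exact Submodule.smul_mem _ _ (sub_mem hf_lead hg_lead)

end Order

section Evaluation

variable {K : Type*} [Field K] {q : ℕ}

theorem evalAt_smul (P : Point K q) (p : K[X]) (f : CoordRing K q) :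
    evalAt P (p • f) = p.eval P.1.1 * evalAt P f := by
  rw [Algebra.smul_def, map_mul]
  congr 1
  exact AdjoinRoot.lift_of _

theorem evalAt_x (P : Point K q) : evalAt P (x K q) = P.1.1 := by
  rw [x, evalAt, AdjoinRoot.lift_of, coe_evalRingHom, eval_X]

theorem evalAt_y (P : Point K q) : evalAt P (y K q) = P.1.2 := by
  rw [y, evalAt, AdjoinRoot.lift_root]

theorem natCast_q_eq_zero [Fintype K] (hK : Fintype.card K = q ^ 2) : (q : K) = 0 := by
  have card_eq_zero := Nat.cast_card_eq_zero K
  rw [hK, Nat.cast_pow] at card_eq_zero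
  exact pow_eq_zero_iff two_ne_zero |>.1 card_eq_zero

variable [Fact (IsPrimePow q)]

theorem sum_pow_mul_map_zstar {A : Type*} [CommRing A] (φ : CoordRing K q →+* A) (b : A) :
    ∑ c : Fin q, b ^ (c : ℕ) * φ (zstar K q c) =
      ∑ c ∈ Finset.range q, b ^ c * φ (y K q) ^ (q - 1 - c) + 1 := by
  have term_eq (c : Fin q) : b ^ (c : ℕ) * φ (zstar K q c) =
      b ^ (c : ℕ) * φ (y K q) ^ (q - 1 - c) + if (c : ℕ) = 0 then 1 else 0 := by
    rw [zstar]
    split_ifs with h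
    · rw [h, pow_zero, one_mul, one_mul, map_add, map_pow, map_one, Nat.sub_zero]
    · rw [map_pow, add_zero]
  simp only [term_eq, Finset.sum_add_distrib]
  rw [Fin.sum_univ_eq_sum_range (fun c => b ^ c * φ (y K q) ^ (q - 1 - c)),
    Fin.sum_univ_eq_sum_range (fun c => if c = 0 then (1 : A) else 0), Finset.sum_ite_eq',
    if_pos (Finset.mem_range.2 (zero_lt_one.trans one_lt_q))]

theorem sum_y_pow_mul_zstar [Fintype K] (hK : Fintype.card K = q ^ 2) :
    ∑ c : Fin q, y K q ^ (c : ℕ) * zstar K q c = 1 := by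
  refine (sum_pow_mul_map_zstar (RingHom.id _) (y K q)).trans ?_
  rw [RingHom.id_apply, geom_sum₂_self, ← map_natCast (algebraMap K (CoordRing K q)),
    natCast_q_eq_zero hK, map_zero, zero_mul, zero_add]

/-- The function `∑ β ^ c z_c^∗` attached to the point `P = (α, β)`. The syndrome series is
the sum over all points of the series of `e_P / (x - α)` times this function. -/
def pointStar (P : Point K q) : CoordRing K q :=
  ∑ c : Fin q, (C (P.1.2 ^ (c : ℕ)) : K[X]) • zstar K q c

theorem trace_mul_pointStar (P : Point K q) (f : CoordRing K q) :
    trace (f * pointStar P) = ∑ c : Fin q, C (P.1.2 ^ (c : ℕ)) * component f c := by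
  rw [pointStar, Finset.mul_sum, map_sum]
  refine Finset.sum_congr rfl fun c _ => ?_
  rw [mul_smul_comm, map_smul, trace_mul_zstar, smul_eq_mul]

theorem eval_trace_mul_pointStar (P : Point K q) (f : CoordRing K q) :
    (trace (f * pointStar P)).eval P.1.1 = evalAt P f := by
  conv_rhs => rw [eq_sum_component f, map_sum]
  rw [trace_mul_pointStar, eval_finsetSum]
  refine Finset.sum_congr rfl fun c _ => ?_
  rw [evalAt_smul, eval_mul, eval_C, map_pow, evalAt_y, mul_comm]

theorem evalAt_pointStar (P Q : Point K q) :
    evalAt Q (pointStar P) = ∑ c ∈ Finset.range q, P.1.2 ^ c * Q.1.2 ^ (q - 1 - c) + 1 := by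
  rw [← evalAt_y Q, ← sum_pow_mul_map_zstar (evalAt Q), pointStar, map_sum]
  simp only [evalAt_smul, eval_C]

theorem evalAt_pointStar_self [Fintype K] (hK : Fintype.card K = q ^ 2) (P : Point K q) :
    evalAt P (pointStar P) = 1 := by
  rw [evalAt_pointStar, geom_sum₂_self, natCast_q_eq_zero hK, zero_mul, zero_add]

theorem evalAt_pointStar_of_ne {P Q : Point K q} (hx : P.1.1 = Q.1.1) (hne : P ≠ Q) :
    evalAt Q (pointStar P) = 0 := by
  have hy : P.1.2 - Q.1.2 ≠ 0 := fun h => hne (Subtype.ext (Prod.ext hx (sub_eq_zero.1 h)))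
  refine (mul_eq_zero.1 (?_ : _ * (P.1.2 - Q.1.2) = 0)).resolve_right hy
  have hP := P.2
  rw [hx] at hP
  rw [evalAt_pointStar, add_mul, geom_sum₂_mul]
  linear_combination Q.2 - hP

end Evaluation

section Residual

variable {K : Type*} [Field K] {q : ℕ}

theorem syndrome_eq_sum [Fintype K] [DecidableEq K] (e : Point K q → K) (a : ℤ) (c : ℕ) :
    syndrome e a c = ∑ P, e P * (P.1.2 ^ c * geomSeq P.1.1 a) := by
  unfold syndrome geomSeq
  split_ifs
  · exact Finset.sum_congr rfl fun P _ => by ring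
  · simp only [mul_zero, Finset.sum_const_zero]

variable [Fact (IsPrimePow q)]

/-- The coefficient of `x ^ (-r - 1)` in the trace of `φ`; it vanishes unless `r < 0`. -/
def polarPart (r : ℤ) : CoordRing K q →ₗ[K] K :=
  (seqPairing (deltaSeq K) r).comp (trace.restrictScalars K)

theorem polarPart_apply (r : ℤ) (φ : CoordRing K q) :
    polarPart r φ = seqPairing (deltaSeq K) r (trace φ) := rfl

theorem polarPart_X_pow_smul (n : ℕ) (r : ℤ) (φ : CoordRing K q) :
    polarPart r ((X ^ n : K[X]) • φ) = polarPart (r + n) φ := by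
  rw [polarPart_apply, map_smul, smul_eq_mul, seqPairing_X_pow_mul, polarPart_apply]

theorem polarPart_of_nonneg {r : ℤ} (hr : 0 ≤ r) (φ : CoordRing K q) : polarPart r φ = 0 := by
  rw [polarPart_apply, seqPairing_deltaSeq, if_neg hr.not_gt]

theorem polarPart_y_pow_mul_zstar (r : ℤ) (b c : Fin q) :
    polarPart r (y K q ^ (b : ℕ) * zstar K q c) = if r = -1 ∧ b = c then 1 else 0 := by
  rw [polarPart_apply, trace_y_pow_mul_zstar, seqPairing_deltaSeq]
  by_cases h : b = c
  · rw [if_pos h, coeff_one]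
    split_ifs <;> first | rfl | omega
  · rw [if_neg h, coeff_zero, ite_self, if_neg fun hrb => h hrb.2]

theorem eq_of_polarPart {φ ψ : CoordRing K q}
    (h : ∀ (r : ℤ) (c : Fin q),
      polarPart r (y K q ^ (c : ℕ) * φ) = polarPart r (y K q ^ (c : ℕ) * ψ)) : φ = ψ := by
  rw [← sub_eq_zero]
  refine eq_zero_of_trace fun c => ext fun n => ?_
  have coeff_eq := sub_eq_zero.2 (h (-n - 1) c)
  rwa [← map_sub, ← mul_sub, polarPart_apply, seqPairing_deltaSeq, if_pos (by omega),
    show (-(-(n : ℤ) - 1) - 1).toNat = n by omega] at coeff_eq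

variable [Fintype K] [DecidableEq K]

/-- The functional `f ↦ ∑ f_{a,c} s_{a + r, c}`. Its value is the coefficient of
`x ^ (-r - 1)` in the trace of `f S`, where `S = ∑ s_{a,c} x ^ (-a - 1) z_c^∗` is the syndrome
series. -/
def syndromePart (e : Point K q → K) (r : ℤ) : CoordRing K q →ₗ[K] K :=
  ∑ c : Fin q, (seqPairing (fun a => syndrome e a c) r).comp
    ((componentHom (c : ℕ)).restrictScalars K)

theorem syndromePart_apply (e : Point K q → K) (r : ℤ) (f : CoordRing K q) :
    syndromePart e r f =
      ∑ c : Fin q, seqPairing (fun a => syndrome e a c) r (component f c) := by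
  rw [syndromePart, LinearMap.sum_apply]
  rfl

theorem discrepancy_eq_syndromePart (e : Point K q → K) (m : ℕ) (s : State K q) (i : Fin q) :
    discrepancy e m s i =
      syndromePart e (shift m s i) (y K q ^ (partner m i : ℕ) * s.f i) := by
  rw [syndromePart_apply, discrepancy]
  exact Finset.sum_congr rfl fun c _ =>
    (seqPairing_apply (fun a => syndrome e a c) _ _).symm

theorem syndromePart_X_pow_smul (e : Point K q → K) (n : ℕ) (r : ℤ) (f : CoordRing K q) :
    syndromePart e r ((X ^ n : K[X]) • f) = syndromePart e (r + n) f := by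
  simp only [syndromePart_apply, component_smul, seqPairing_X_pow_mul]

theorem syndromePart_eq_sum (e : Point K q → K) (r : ℤ) (f : CoordRing K q) :
    syndromePart e r f =
      ∑ P, e P * seqPairing (geomSeq P.1.1) r (trace (f * pointStar P)) := by
  simp only [syndromePart_apply, trace_mul_pointStar, map_sum, ← smul_eq_C_mul, map_smul,
    smul_eq_mul, Finset.mul_sum]
  rw [Finset.sum_comm]
  refine Finset.sum_congr rfl fun c _ => ?_
  simp only [seqPairing_apply, Polynomial.sum, syndrome_eq_sum, Finset.mul_sum]
  rw [Finset.sum_comm]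
  exact Finset.sum_congr rfl fun P _ => Finset.sum_congr rfl fun a _ => by ring

theorem syndromePart_of_nonneg (e : Point K q → K) {r : ℤ} (hr : 0 ≤ r) (f : CoordRing K q) :
    syndromePart e r f = ∑ P, e P * (P.1.1 ^ r.toNat * evalAt P f) := by
  simp only [syndromePart_eq_sum, seqPairing_geomSeq_of_nonneg _ hr, eval_trace_mul_pointStar]

theorem syndromePart_y_pow_of_neg (e : Point K q → K) {r : ℤ} (hr : r < 0) {c : ℕ}
    (hc : c < q) : syndromePart e r (y K q ^ c) = 0 := by
  rw [syndromePart_apply]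
  refine Finset.sum_eq_zero fun b _ => ?_
  rw [show component (y K q ^ c) b = if b = ⟨c, hc⟩ then 1 else 0 from component_y_pow b ⟨c, hc⟩]
  split_ifs
  · rw [← monomial_zero_one, seqPairing_monomial, syndrome, if_neg (by simpa using hr), mul_zero]
  · rw [map_zero]

theorem syndromePart_y_pow_of_weight_neg (e : Point K q → K) {r : ℤ} {n : ℕ}
    (hn : n < 2 * q - 1) (h : weight q r n < 0) : syndromePart e r (y K q ^ n) = 0 := by
  have neg_of_weight_neg {r : ℤ} {c : ℕ} (h : weight q r c < 0) : r < 0 := by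
    by_contra! hr
    obtain ⟨a, rfl⟩ := Int.eq_ofNat_of_zero_le hr
    exact h.not_ge (weight_natCast_nonneg q a c)
  rcases lt_or_ge n q with hnq | hnq
  · exact syndromePart_y_pow_of_neg e (neg_of_weight_neg h) hnq
  · obtain ⟨b, rfl⟩ := Nat.exists_eq_add_of_le hnq
    have reduce : y K q ^ (q + b) = (X ^ (q + 1) : K[X]) • y K q ^ b - y K q ^ (b + 1) := by
      rw [← x_pow_mul, pow_add, y_pow_q]
      ring
    rw [reduce, map_sub, syndromePart_X_pow_smul, syndromePart_y_pow_of_neg e _ (by omega),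
      syndromePart_y_pow_of_neg e (neg_of_weight_neg h) (by omega), sub_zero]
    refine neg_of_weight_neg (c := b) ?_
    rw [weight_add]
    unfold weight at h ⊢
    push_cast at h ⊢
    linarith

/-- For a pair `(f, φ)`, the coefficient of `x ^ (-r - 1)` in the trace of `f S - φ`, where `S`
is the syndrome series. -/
def residual (e : Point K q → K) (r : ℤ) : CoordRing K q × CoordRing K q →ₗ[K] K :=
  (syndromePart e r).comp (LinearMap.fst K _ _) - (polarPart r).comp (LinearMap.snd K _ _)

theorem residual_apply (e : Point K q → K) (r : ℤ) (v : CoordRing K q × CoordRing K q) :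
    residual e r v = syndromePart e r v.1 - polarPart r v.2 := rfl

theorem residual_X_pow_smul (e : Point K q → K) (n : ℕ) (r : ℤ)
    (v : CoordRing K q × CoordRing K q) :
    residual e r ((X ^ n : K[X]) • v) = residual e (r + n) v := by
  rw [residual_apply, residual_apply, Prod.smul_fst, Prod.smul_snd, syndromePart_X_pow_smul,
    polarPart_X_pow_smul]

end Residual

section Filtrations

variable {K : Type*} [Field K] {q : ℕ} [Fact (IsPrimePow q)]

/-- The functions `φ` whose polar part at `x ^ r y ^ c` vanishes as soon as this monomial has
order at least `n`. -/
def polarLT (K : Type*) [Field K] (q : ℕ) [Fact (IsPrimePow q)] (n : ℤ) :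
    Submodule K (CoordRing K q) where
  carrier := {φ | ∀ r (c : Fin q), n ≤ weight q r c → polarPart r (y K q ^ (c : ℕ) * φ) = 0}
  zero_mem' r c _ := by rw [mul_zero, map_zero]
  add_mem' hφ hψ r c h := by rw [mul_add, map_add, hφ r c h, hψ r c h, add_zero]
  smul_mem' u φ hφ r c h := by rw [mul_smul_comm, map_smul, hφ r c h, smul_zero]

theorem polarLT_mono {m n : ℤ} (h : m ≤ n) : polarLT K q m ≤ polarLT K q n :=
  fun _ hφ r c hn => hφ r c (h.trans hn)

theorem X_pow_smul_mem_polarLT {φ : CoordRing K q} {m n : ℤ} (k : ℕ) (hφ : φ ∈ polarLT K q m)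
    (h : m ≤ n + k * q) : (X ^ k : K[X]) • φ ∈ polarLT K q n := by
  intro r c hn
  rw [mul_smul_comm, polarPart_X_pow_smul]
  refine hφ _ c ?_
  rw [weight_add]
  linarith

variable [Fintype K] [DecidableEq K]

/-- The pairs whose residual at `x ^ r y ^ c` vanishes as soon as this monomial has order less
than `n`. -/
def residualGE (e : Point K q → K) (n : ℤ) : Submodule K (CoordRing K q × CoordRing K q) where
  carrier := {v | ∀ r (c : Fin q), weight q r c < n → residual e r (y K q ^ (c : ℕ) • v) = 0}
  zero_mem' r c _ := by rw [smul_zero, map_zero]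
  add_mem' hv hw r c h := by rw [smul_add, map_add, hv r c h, hw r c h, add_zero]
  smul_mem' u v hv r c h := by rw [smul_comm, map_smul, hv r c h, smul_zero]

variable {e : Point K q → K} {v w : CoordRing K q × CoordRing K q} {m n : ℤ}

theorem residualGE_anti (h : m ≤ n) : residualGE e n ≤ residualGE e m :=
  fun _ hv r c hm => hv r c (hm.trans_le h)

theorem X_pow_smul_mem_residualGE (k : ℕ) (hv : v ∈ residualGE e m) (h : n + k * q ≤ m) :
    (X ^ k : K[X]) • v ∈ residualGE e n := by
  intro r c hn
  rw [smul_comm, residual_X_pow_smul]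
  refine hv _ c ?_
  rw [weight_add]
  linarith

theorem sub_mem_residualGE_add_one (hv : v ∈ residualGE e n) (hw : w ∈ residualGE e n) {r : ℤ}
    {c : Fin q} (hn : weight q r c = n)
    (h : residual e r (y K q ^ (c : ℕ) • v) = residual e r (y K q ^ (c : ℕ) • w)) :
    v - w ∈ residualGE e (n + 1) := by
  intro r' c' hlt
  rcases (Int.lt_add_one_iff.1 hlt).lt_or_eq with hlt | heq
  · exact sub_mem hv hw r' c' hlt
  · obtain ⟨rfl, rfl⟩ := weight_inj.1 (heq.trans hn.symm)
    rw [smul_sub, map_sub, h, sub_self]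

theorem residual_smul_eq_zero {f : CoordRing K q} {r : ℤ} (hf : f ∈ orderLT K q m)
    (hv : v ∈ residualGE e n) (h : m + r * q ≤ n) : residual e r (f • v) = 0 := by
  refine map_eq_zero_of_mem_orderLT (L := (residual e r).comp
    ((LinearMap.toSpanSingleton (CoordRing K q) _ v).restrictScalars K)) (fun a c hac => ?_) hf
  change residual e r (((X ^ a : K[X]) • y K q ^ (c : ℕ)) • v) = 0
  rw [smul_assoc, residual_X_pow_smul]
  refine hv _ c ?_
  rw [add_comm, weight_add]
  linarith

theorem HasMonicLead.residual_smul {f : CoordRing K q} {k : ℕ} {i : Fin q}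
    (hf : HasMonicLead f k i) {r : ℤ} (hv : v ∈ residualGE e (weight q (r + k) i)) :
    residual e r (f • v) = residual e (r + k) (y K q ^ (i : ℕ) • v) := by
  have vanish := residual_smul_eq_zero hf hv (r := r) (by rw [add_comm r, weight_add])
  rwa [sub_smul, map_sub, smul_assoc, residual_X_pow_smul, sub_eq_zero] at vanish

end Filtrations

section LocalStep

variable {K : Type*} [Field K] [DecidableEq K]

/-- The update matrix for discrepancy `μ` and gap `p`, with entries in `K[X]`. -/
def updatePoly (μ : K) (p : ℤ) : Matrix (Fin 2) (Fin 2) K[X] :=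
  if μ = 0 ∨ 0 ≤ p then !![1, -(C μ * X ^ p.toNat); 0, 1]
  else !![X ^ (-p).toNat, -C μ; C μ⁻¹, 0]

/-- The exponent of `x` in the leading monomial of `f_i` after an update with discrepancy `μ`
and gap `p`, when it was `k` before. -/
def nextExponent (μ : K) (p : ℤ) (k : ℕ) : ℕ :=
  if μ = 0 ∨ 0 ≤ p then k else k + (-p).toNat

theorem det_updatePoly (μ : K) (p : ℤ) : (updatePoly μ p).det = 1 := by
  unfold updatePoly
  split_ifs with h
  · rw [Matrix.det_fin_two_of, mul_one, mul_zero, sub_zero]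
  · rw [Matrix.det_fin_two_of, mul_zero, zero_sub, neg_mul, neg_neg, ← C_mul,
      mul_inv_cancel₀ fun hμ => h (Or.inl hμ), C_1]

variable {q : ℕ} [Fact (IsPrimePow q)] [Fintype K]

/-- The part of the invariant before iteration `m` that concerns `v = (f_i, φ_i)` and
`w = (g_i, ψ_i)` alone, with `x ^ k y ^ i` the leading monomial of `f_i`. -/
structure LocalInvariant (e : Point K q → K) (m : ℤ) (v w : CoordRing K q × CoordRing K q)
    (k : ℕ) (i : Fin q) : Prop where
  lead : HasMonicLead v.1 k i
  left_residual : v ∈ residualGE e (m - weight q k i)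
  left_polar : v.2 ∈ polarLT K q (m - weight q k i)
  right_residual : w ∈ residualGE e (weight q (k - 1) i)
  right_residual_lead : residual e (k - 1) (y K q ^ (i : ℕ) • w) = 1
  right_polar : w.2 ∈ polarLT K q (weight q (k - 1) i + 1)
  right_order : w.1 ∈ orderLT K q (m - weight q (k - 1) i)

namespace LocalInvariant

variable {e : Point K q → K} {m : ℤ} {v w v' w' : CoordRing K q × CoordRing K q} {k k' : ℕ}
  {i j : Fin q}

theorem of_residual_eq_zero (h : LocalInvariant e m v w k i) {r : ℤ}
    (hr : weight q r j = m - weight q k i) (h0 : residual e r (y K q ^ (j : ℕ) • v) = 0) :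
    LocalInvariant e (m + 1) v w k i where
  lead := h.lead
  left_residual := by
    rw [add_sub_right_comm, ← sub_zero v]
    refine sub_mem_residualGE_add_one h.left_residual (zero_mem _) hr ?_
    rw [h0, smul_zero, map_zero]
  left_polar := polarLT_mono (by linarith) h.left_polar
  right_residual := h.right_residual
  right_residual_lead := h.right_residual_lead
  right_polar := h.right_polar
  right_order := orderLT_mono (by linarith) h.right_order

theorem sub_smul_X_pow_smul (h : LocalInvariant e m v w k i) (h' : LocalInvariant e m v' w' k' j)
    {n : ℕ} (hgap : weight q k i + weight q k' j = m + (n + 1) * q) {μ : K}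
    (hμ : residual e (k' - 1 - n) (y K q ^ (j : ℕ) • v) = μ) :
    LocalInvariant e (m + 1) (v - μ • (X ^ n : K[X]) • w') w k i := by
  have hr : weight q (k' - 1 - n) j = m - weight q k i := by unfold weight at *; linarith
  refine ⟨h.lead.sub ?_, ?_, ?_, h.right_residual, h.right_residual_lead, h.right_polar,
    orderLT_mono (by linarith) h.right_order⟩
  · refine Submodule.smul_mem _ _ (X_pow_smul_mem_orderLT n h'.right_order ?_)
    unfold weight at *; linarith
  · rw [add_sub_right_comm]
    refine sub_mem_residualGE_add_one h.left_residual (Submodule.smul_mem _ _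
      (X_pow_smul_mem_residualGE n h'.right_residual ?_)) hr ?_
    · unfold weight at *; linarith
    · rw [hμ, smul_comm _ μ, map_smul, smul_comm _ (X ^ n : K[X]), residual_X_pow_smul,
        sub_add_cancel, h'.right_residual_lead, smul_eq_mul, mul_one]
  · refine sub_mem (polarLT_mono (by linarith) h.left_polar)
      (Submodule.smul_mem _ _ (X_pow_smul_mem_polarLT n h'.right_polar ?_))
    unfold weight at *; linarith

theorem X_pow_smul_sub_smul (h : LocalInvariant e m v w k i) (h' : LocalInvariant e m v' w' k' j)
    {n : ℕ} (hgap : weight q k i + weight q k' j = m + (-n + 1) * q) {μ : K} (hμ0 : μ ≠ 0)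
    (hμ : residual e (k' - 1 + n) (y K q ^ (j : ℕ) • v) = μ)
    (hμ' : residual e (k - 1 + n) (y K q ^ (i : ℕ) • v') = μ) :
    LocalInvariant e (m + 1) ((X ^ n : K[X]) • v - μ • w') (μ⁻¹ • v') (k + n) i := by
  have right_weight : weight q ((k + n : ℕ) - 1) i = m - weight q k' j := by
    unfold weight at *; push_cast; linarith
  have left_weight : m + 1 - weight q (k + n : ℕ) i = weight q (k' - 1) j + 1 := by
    unfold weight at *; push_cast; linarith
  refine ⟨(h.lead.X_pow_smul n).sub (Submodule.smul_mem _ _ (orderLT_mono ?_ h'.right_order)),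
    ?_, ?_, ?_, ?_, ?_, ?_⟩
  · linarith
  · rw [left_weight]
    refine sub_mem_residualGE_add_one (X_pow_smul_mem_residualGE n h.left_residual ?_)
      (Submodule.smul_mem _ _ h'.right_residual) rfl ?_
    · unfold weight at *; linarith
    · rw [smul_comm _ (X ^ n : K[X]), residual_X_pow_smul, hμ, smul_comm, map_smul,
        h'.right_residual_lead, smul_eq_mul, mul_one]
  · rw [left_weight]
    refine sub_mem (X_pow_smul_mem_polarLT n h.left_polar ?_)
      (Submodule.smul_mem _ _ h'.right_polar)
    unfold weight at *; linarith
  · rw [right_weight]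
    exact Submodule.smul_mem _ _ h'.left_residual
  · rw [Nat.cast_add, add_sub_right_comm, smul_comm, map_smul, hμ', smul_eq_mul,
      inv_mul_cancel₀ hμ0]
  · rw [right_weight]
    exact Submodule.smul_mem _ _ (polarLT_mono (by linarith) h'.left_polar)
  · rw [right_weight]
    exact Submodule.smul_mem _ _ (h'.lead.mem_orderLT (by linarith))

theorem update (h : LocalInvariant e m v w k i) (h' : LocalInvariant e m v' w' k' j) {p : ℤ}
    (hgap : weight q k i + weight q k' j = m + (p + 1) * q) {μ : K}
    (hμ : residual e (k' - 1 - p) (y K q ^ (j : ℕ) • v) = μ)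
    (hμ' : residual e (k - 1 - p) (y K q ^ (i : ℕ) • v') = μ) :
    LocalInvariant e (m + 1) (updatePoly μ p 0 0 • v + updatePoly μ p 0 1 • w')
      (updatePoly μ p 1 0 • v' + updatePoly μ p 1 1 • w) (nextExponent μ p k) i := by
  unfold updatePoly nextExponent
  split_ifs with hc
  · simp only [Matrix.of_apply, Matrix.cons_val', Matrix.cons_val_zero, Matrix.cons_val_one,
      Matrix.cons_val_fin_one, one_smul, zero_smul, zero_add, neg_smul, ← sub_eq_add_neg]
    rcases eq_or_ne μ 0 with rfl | hμ0
    · rw [C_0, zero_mul, zero_smul, sub_zero]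
      exact h.of_residual_eq_zero (by unfold weight at *; linarith) hμ
    · obtain ⟨n, rfl⟩ := Int.eq_ofNat_of_zero_le (hc.resolve_left hμ0)
      rw [mul_smul, ← smul_eq_C_smul]
      exact h.sub_smul_X_pow_smul h' hgap hμ
  · obtain ⟨hμ0, hp⟩ := not_or.1 hc
    obtain ⟨n, hn⟩ := Int.eq_ofNat_of_zero_le (neg_nonneg.2 (not_le.1 hp).le)
    obtain rfl : p = -n := by rw [← hn, neg_neg]
    simp only [Matrix.of_apply, Matrix.cons_val', Matrix.cons_val_zero, Matrix.cons_val_one,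
      Matrix.cons_val_fin_one, zero_smul, add_zero, neg_smul, ← sub_eq_add_neg, neg_neg,
      Int.toNat_natCast, ← smul_eq_C_smul]
    rw [sub_neg_eq_add] at hμ hμ'
    exact h.X_pow_smul_sub_smul h' hgap hμ0 hμ hμ'

end LocalInvariant

end LocalStep

section Partner

theorem exists_eq_add_partner {q : ℕ} (m : ℕ) (i : Fin q) :
    ∃ n : ℤ, (m : ℤ) = (i : ℕ) + (partner m i : ℕ) + n * q := by
  refine ⟨((m + (q - i)) / q : ℕ) - 1, ?_⟩
  have mod_add_div := Nat.mod_add_div' (m + (q - i)) q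
  zify [i.2.le] at mod_add_div
  change (m : ℤ) = (i : ℕ) + ((m + (q - i)) % q : ℕ) + _
  push_cast [i.2.le]
  linarith

theorem partner_involutive (q m : ℕ) : (partner m : Fin q → Fin q).Involutive := by
  intro i
  obtain ⟨n, hn⟩ := exists_eq_add_partner m i
  obtain ⟨n', hn'⟩ := exists_eq_add_partner m (partner m i)
  refine (weight_inj (r := n' - (partner m (partner m i) : ℕ)) (r' := n - (i : ℕ)).1 ?_).2
  unfold weight
  linarith

end Partner

section Step

variable {K : Type*} [Field K] {q : ℕ}

/-- The pair `(f_i, φ_i)`. -/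
def State.fPair (s : State K q) (i : Fin q) : CoordRing K q × CoordRing K q := (s.f i, s.φ i)

/-- The pair `(g_i, ψ_i)`. -/
def State.gPair (s : State K q) (i : Fin q) : CoordRing K q × CoordRing K q := (s.g i, s.ψ i)

variable [Fact (IsPrimePow q)]

/-- The alternating form `((f, φ), (g, ψ)) ↦ Tr (φ g - f ψ)`. -/
def traceForm (K : Type*) [Field K] (q : ℕ) [Fact (IsPrimePow q)] :
    CoordRing K q × CoordRing K q →ₗ[K[X]] CoordRing K q × CoordRing K q →ₗ[K[X]] K[X] :=
  (pairForm K[X] (CoordRing K q)).compr₂ trace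

theorem traceForm_apply (u v : CoordRing K q × CoordRing K q) :
    traceForm K q u v = trace (u.2 * v.1 - u.1 * v.2) := rfl

theorem traceForm_isAlt : (traceForm K q).IsAlt := fun u => by
  rw [traceForm, LinearMap.compr₂_apply, pairForm_isAlt, map_zero]

theorem gap_partner (m : ℕ) (s : State K q) (i : Fin q) :
    gap m s (partner m i) = gap m s i := by
  rw [gap, gap, partner_involutive, add_comm (rho _ : ℤ)]

variable [Fintype K] [DecidableEq K]

theorem residual_smul_comm (e : Point K q → K) (r : ℤ) {u v : CoordRing K q × CoordRing K q}
    (h : traceForm K q u v = 0) : residual e r (u.1 • v) = residual e r (v.1 • u) := by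
  rw [traceForm_apply, map_sub, sub_eq_zero, mul_comm u.2] at h
  simp only [residual_apply, Prod.smul_fst, Prod.smul_snd, smul_eq_mul, polarPart_apply, h,
    mul_comm u.1]

/-- The family of update matrices of iteration `m`, with entries in `K[X]`. -/
def stepMatrix (e : Point K q → K) (m : ℕ) (s : State K q) (i : Fin q) :
    Matrix (Fin 2) (Fin 2) K[X] :=
  updatePoly (discrepancy e m s i) (gap m s i)

theorem updateMatrix_eq_map (e : Point K q → K) (m : ℕ) (s : State K q) (i : Fin q) :
    updateMatrix e m s i = (stepMatrix e m s i).map (algebraMap K[X] (CoordRing K q)) := by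
  have map_X_pow (n : ℕ) : algebraMap K[X] (CoordRing K q) (X ^ n) = x K q ^ n := map_pow ..
  have map_C (u : K) :
      algebraMap K (CoordRing K q) u = AdjoinRoot.of (curvePoly K q) (C u) := rfl
  unfold updateMatrix stepMatrix updatePoly
  ext a b
  split_ifs <;> fin_cases a <;> fin_cases b <;> simp [map_C, ← map_X_pow]

theorem fPair_step (e : Point K q → K) (m : ℕ) (s : State K q) :
    (step e m s).fPair = blockLeft (stepMatrix e m s) (partner m) s.fPair s.gPair := by
  funext i
  simp only [blockLeft, State.fPair, State.gPair, step, updatedBlock, updateMatrix_eq_map,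
    Matrix.mul_apply, Fin.sum_univ_two, Algebra.smul_def]
  rfl

theorem gPair_step {e : Point K q → K} {m : ℕ} {s : State K q}
    (hU : ∀ i, stepMatrix e m s (partner m i) = stepMatrix e m s i) :
    (step e m s).gPair = blockRight (stepMatrix e m s) (partner m) s.fPair s.gPair := by
  funext i
  simp only [blockRight, State.fPair, State.gPair, step, updatedBlock, updateMatrix_eq_map,
    Matrix.mul_apply, Fin.sum_univ_two, Algebra.smul_def, hU, partner_involutive q m i]
  rfl

/-- What holds before iteration `m`, with `x ^ (k i) y ^ i` the leading monomial of `f_i`. -/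
structure Invariant (e : Point K q → K) (m : ℕ) (s : State K q) (k : Fin q → ℕ) : Prop where
  atIndex (i : Fin q) : LocalInvariant e m (s.fPair i) (s.gPair i) (k i) i
  symplectic : IsSymplectic (traceForm K q) s.fPair s.gPair
  sum_pairForm : ∑ i, pairForm K[X] (CoordRing K q) (s.fPair i) (s.gPair i) = 1

theorem LocalInvariant.initialState (e : Point K q → K) (i : Fin q) :
    LocalInvariant e 0 ((initialState K q).fPair i) ((initialState K q).gPair i) 0 i := by
  have residual_gPair (r : ℤ) (c : Fin q) :
      residual e r (y K q ^ (c : ℕ) • (Hermitian.initialState K q).gPair i) =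
        if r = -1 ∧ c = i then 1 else 0 := by
    rw [residual_apply, Prod.smul_fst, Prod.smul_snd]
    simp only [State.gPair, Hermitian.initialState, smul_eq_mul, mul_zero, map_zero, mul_neg,
      map_neg, polarPart_y_pow_mul_zstar, sub_neg_eq_add, zero_add]
  refine ⟨hasMonicLead_y_pow i, fun r c hr => ?_, zero_mem _, fun r c hr => ?_, ?_,
    fun r c hr => ?_, zero_mem _⟩
  · rw [residual_apply, Prod.smul_fst, Prod.smul_snd]
    simp only [State.fPair, Hermitian.initialState, smul_eq_mul, mul_zero, map_zero, sub_zero,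
      ← pow_add]
    refine syndromePart_y_pow_of_weight_neg e (by omega) ?_
    unfold weight at *; push_cast at *; linarith
  · rw [residual_gPair, if_neg]
    rintro ⟨rfl, rfl⟩
    simp at hr
  · rw [residual_gPair, if_pos ⟨by simp, rfl⟩]
  · change polarPart r (_ * -zstar K q i) = 0
    rw [mul_neg, map_neg, polarPart_y_pow_mul_zstar, if_neg, neg_zero]
    rintro ⟨rfl, rfl⟩
    simp at hr

namespace Invariant

theorem initialState (hK : Fintype.card K = q ^ 2) (e : Point K q → K) :
    Invariant e 0 (initialState K q) fun _ => 0 where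
  atIndex := LocalInvariant.initialState e
  symplectic := by
    refine ⟨fun i k => ?_, fun i k => ?_, fun i k => ?_⟩ <;>
      simp only [traceForm_apply, State.fPair, State.gPair, Hermitian.initialState, mul_zero,
        zero_mul, mul_neg, sub_neg_eq_add, zero_add, sub_self, map_zero, neg_zero,
        trace_y_pow_mul_zstar]
  sum_pairForm := by
    simp only [pairForm_apply, State.fPair, State.gPair, Hermitian.initialState, zero_mul,
      mul_neg, sub_neg_eq_add, zero_add, sum_y_pow_mul_zstar hK]

variable {e : Point K q → K} {m : ℕ} {s : State K q} {k : Fin q → ℕ}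

theorem rho_eq (h : Invariant e m s k) (i : Fin q) : (rho (s.f i) : ℤ) = weight q (k i) i :=
  (h.atIndex i).lead.rho_eq

theorem weight_add_weight (h : Invariant e m s k) (i : Fin q) :
    weight q (k i) i + weight q (k (partner m i)) (partner m i) =
      m + (gap m s i + 1) * q := by
  obtain ⟨n, hn⟩ := exists_eq_add_partner m i
  have sum_eq : (rho (s.f i) : ℤ) + rho (s.f (partner m i)) - m =
      (k i + k (partner m i) + (i : ℕ) + (partner m i : ℕ) - n) * q := by
    rw [h.rho_eq, h.rho_eq, weight, weight]
    linear_combination -hn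
  rw [gap, sub_add_cancel, sum_eq, Int.mul_ediv_cancel _ (by exact_mod_cast i.pos.ne'), ← sum_eq,
    h.rho_eq, h.rho_eq, add_sub_cancel]

theorem shift_eq (h : Invariant e m s k) (i : Fin q) :
    shift m s i = k (partner m i) - 1 - gap m s i := by
  have num_eq : (m : ℤ) - rho (s.f i) - (partner m i : ℕ) * (q + 1) =
      (k (partner m i) - 1 - gap m s i) * q := by
    have weights := h.weight_add_weight i
    rw [← h.rho_eq, weight] at weights
    linear_combination -weights
  rw [shift, num_eq, Int.mul_ediv_cancel _ (by exact_mod_cast i.pos.ne')]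

theorem discrepancy_eq_residual (h : Invariant e m s k) (i : Fin q) :
    discrepancy e m s i =
      residual e (k (partner m i) - 1 - gap m s i) (y K q ^ (partner m i : ℕ) • s.fPair i) := by
  rw [discrepancy_eq_syndromePart, residual_apply, h.shift_eq, Prod.smul_snd, smul_eq_mul,
    (h.atIndex i).left_polar _ _ ?_, sub_zero]
  · rfl
  · have weights := h.weight_add_weight i
    unfold weight at *; linarith

theorem discrepancy_eq_residual_f_smul (h : Invariant e m s k) (i : Fin q) :
    discrepancy e m s i =
      residual e (-1 - gap m s i) ((s.fPair (partner m i)).1 • s.fPair i) := by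
  rw [(h.atIndex (partner m i)).lead.residual_smul, h.discrepancy_eq_residual]
  · congr 2
    ring
  · refine residualGE_anti ?_ (h.atIndex i).left_residual
    have weights := h.weight_add_weight i
    unfold weight at *; linarith

theorem discrepancy_partner (h : Invariant e m s k) (i : Fin q) :
    discrepancy e m s (partner m i) = discrepancy e m s i := by
  rw [h.discrepancy_eq_residual_f_smul, h.discrepancy_eq_residual_f_smul, gap_partner,
    partner_involutive q m i]
  exact residual_smul_comm e _ (h.symplectic.left_left i (partner m i))

theorem stepMatrix_partner (h : Invariant e m s k) (i : Fin q) :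
    stepMatrix e m s (partner m i) = stepMatrix e m s i := by
  rw [stepMatrix, stepMatrix, h.discrepancy_partner, gap_partner]

theorem step (h : Invariant e m s k) : Invariant e (m + 1) (step e m s)
    fun i => nextExponent (discrepancy e m s i) (gap m s i) (k i) := by
  have hσ := partner_involutive q m
  have det_eq_one (i : Fin q) : (stepMatrix e m s i).det = 1 := det_updatePoly _ _
  refine ⟨fun i => ?_, ?_, ?_⟩ <;> rw [fPair_step, gPair_step h.stepMatrix_partner]
  · have discrepancy_eq := h.discrepancy_eq_residual (partner m i)
    rw [h.discrepancy_partner, gap_partner, hσ i] at discrepancy_eq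
    rw [Nat.cast_succ]
    exact (h.atIndex i).update (h.atIndex (partner m i)) (h.weight_add_weight i)
      (h.discrepancy_eq_residual i).symm discrepancy_eq.symm
  · exact h.symplectic.block traceForm_isAlt hσ h.stepMatrix_partner det_eq_one
  · rw [sum_block pairForm_isAlt hσ h.stepMatrix_partner det_eq_one, h.sum_pairForm]

end Invariant

theorem exists_invariant (hK : Fintype.card K = q ^ 2) (e : Point K q → K) (m : ℕ) :
    ∃ k, Invariant e m (stateAt e m) k := by
  induction m with
  | zero => exact ⟨_, Invariant.initialState hK e⟩
  | succ m ih =>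
    obtain ⟨k, hk⟩ := ih
    exact ⟨_, hk.step⟩

end Step

section Interpolation

variable {K : Type*} [Field K] [Fintype K]

/-- The polynomial `(X ^ |K| - X) / (X - α)`. -/
def cofactor (α : K) : K[X] := (X ^ Fintype.card K - X) /ₘ (X - C α)

theorem X_sub_C_mul_cofactor (α : K) : (X - C α) * cofactor α = X ^ Fintype.card K - X := by
  refine mul_divByMonic_eq_iff_isRoot.2 ?_
  rw [IsRoot.def, eval_sub, eval_pow, eval_X, FiniteField.pow_card, sub_self]

variable [DecidableEq K]

theorem eval_cofactor (α β : K) : (cofactor α).eval β = if α = β then -1 else 0 := by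
  split_ifs with h
  · subst h
    have deriv_eq := congrArg (fun p => eval α (derivative p)) (X_sub_C_mul_cofactor α)
    simpa [derivative_X_pow] using deriv_eq
  · have eval_eq := congrArg (eval β) (X_sub_C_mul_cofactor α)
    simp only [eval_mul, eval_sub, eval_X, eval_C, eval_pow, FiniteField.pow_card, sub_self,
      mul_eq_zero] at eval_eq
    exact eval_eq.resolve_left fun h0 => h (sub_eq_zero.1 h0).symm

variable {q : ℕ} [Fact (IsPrimePow q)]

/-- The function with prescribed values `u P` at the points. Up to the sign it is
`x ^ |K| - x` times the syndrome series of `u`. -/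
def interpolant (u : Point K q → K) : CoordRing K q :=
  -∑ P, (C (u P) * cofactor P.1.1) • pointStar P

theorem evalAt_interpolant (hK : Fintype.card K = q ^ 2) (u : Point K q → K) (Q : Point K q) :
    evalAt Q (interpolant u) = u Q := by
  rw [interpolant, map_neg, map_sum, Finset.sum_eq_single Q, neg_eq_iff_eq_neg]
  · rw [evalAt_smul, eval_mul, eval_C, eval_cofactor, if_pos rfl, evalAt_pointStar_self hK,
      mul_neg_one, mul_one]
  · intro P _ hPQ
    rw [evalAt_smul, eval_mul, eval_cofactor]
    split_ifs with hx
    · rw [evalAt_pointStar_of_ne hx hPQ, mul_zero]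
    · rw [mul_zero, zero_mul]
  · exact fun h => absurd (Finset.mem_univ Q) h

theorem syndromePart_X_pow_card_sub_X_smul (e : Point K q → K) (r : ℤ) (f : CoordRing K q) :
    syndromePart e r ((X ^ Fintype.card K - X : K[X]) • f) = -polarPart r (f * interpolant e) := by
  rw [syndromePart_eq_sum, interpolant, mul_neg, map_neg, neg_neg, Finset.mul_sum, map_sum]
  refine Finset.sum_congr rfl fun P _ => ?_
  rw [← X_sub_C_mul_cofactor P.1.1, mul_smul, smul_mul_assoc, map_smul, smul_eq_mul,
    seqPairing_geomSeq_X_sub_C_mul, mul_smul, ← smul_eq_C_smul, mul_smul_comm, map_smul,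
    smul_eq_mul, smul_mul_assoc, mul_smul_comm, polarPart_apply]

end Interpolation

section Locator

theorem weight_modEq (q : ℕ) (r : ℤ) (c : ℕ) : weight q r c ≡ c [ZMOD q] := by
  refine (Int.modEq_of_dvd ⟨r + c, ?_⟩).symm
  unfold weight
  ring

theorem modEq_iff_of_eq_weight {q d : ℕ} {r : ℤ} {i j : Fin q} (hd : (d : ℤ) = weight q r j) :
    d ≡ i [MOD q] ↔ j = i := by
  have d_modEq : d ≡ j [MOD q] := Int.natCast_modEq_iff.1 (hd ▸ weight_modEq q r j)
  refine ⟨fun h => Fin.ext ((d_modEq.symm.trans h).eq_of_lt_of_lt j.2 i.2), ?_⟩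
  rintro rfl
  exact d_modEq

variable {K : Type*} [Field K] [Finite K] {q : ℕ} {e : Point K q → K}

theorem exists_mem_errorLocatorIdeal_hasMonicLead (e : Point K q → K) (i : Fin q) :
    ∃ f ∈ errorLocatorIdeal e, ∃ k, HasMonicLead f k i := by
  have := Fintype.ofFinite K
  refine ⟨(X ^ Fintype.card K : K[X]) • y K q ^ (i : ℕ) - (X ^ 1 : K[X]) • y K q ^ (i : ℕ),
    fun P _ => ?_, 0 + Fintype.card K, ((hasMonicLead_y_pow i).X_pow_smul _).sub ?_⟩
  · rw [map_sub, evalAt_smul, evalAt_smul, eval_pow, eval_pow, eval_X, FiniteField.pow_card,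
      pow_one, sub_self]
  · refine X_pow_smul_y_pow_mem_orderLT (weight_lt_weight.2 ?_)
    rw [zero_add]
    exact_mod_cast Fintype.one_lt_card

variable [Fact (IsPrimePow q)]

theorem exists_mem_errorLocatorIdeal_sigma (e : Point K q → K) (i : Fin q) :
    ∃ f ∈ errorLocatorIdeal e, ∃ k, HasMonicLead f k i ∧ (sigma e i : ℤ) = weight q k i := by
  have orders_nonempty : {d | d ≡ i [MOD q] ∧
      ∃ f ∈ errorLocatorIdeal e, f ≠ 0 ∧ rho f = d}.Nonempty := by
    obtain ⟨f, hf, k, hk⟩ := exists_mem_errorLocatorIdeal_hasMonicLead e i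
    exact ⟨rho f, (modEq_iff_of_eq_weight hk.rho_eq).2 rfl, f, hf, hk.ne_zero, rfl⟩
  obtain ⟨hmod, f, hf, hf0, hrho⟩ := Nat.sInf_mem orders_nonempty
  obtain ⟨u, k, j, -, hk, hlead⟩ := exists_hasMonicLead_smul hf0
  rw [hrho] at hk
  obtain rfl := (modEq_iff_of_eq_weight hk).1 hmod
  exact ⟨u • f, Submodule.smul_of_tower_mem _ u hf, k, hlead, hk⟩

theorem exists_lt_sigma_of_mem_footprint {d : ℕ} (hd : d ∈ footprint e) :
    ∃ i, d < sigma e i := by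
  obtain ⟨⟨f, hf, rfl⟩, not_rho⟩ := hd
  obtain ⟨u, k, i, -, hk, -⟩ := exists_hasMonicLead_smul hf
  refine ⟨i, ?_⟩
  by_contra! hle
  obtain ⟨g, hg, n, hn, hsigma⟩ := exists_mem_errorLocatorIdeal_sigma e i
  have hnk : n ≤ k := by
    by_contra! hlt
    have := weight_lt_weight (c := i).2 (Int.ofNat_lt.2 hlt)
    omega
  have multiple_lead := hn.X_pow_smul (k - n)
  rw [Nat.add_sub_cancel' hnk] at multiple_lead
  refine not_rho ⟨_, Submodule.smul_of_tower_mem _ _ hg, multiple_lead.ne_zero, ?_⟩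
  exact_mod_cast multiple_lead.rho_eq.trans hk.symm

theorem le_sSup_footprint {d : ℕ} (hd : d ∈ footprint e) : d ≤ sSup (footprint e) := by
  refine le_csSup ⟨(Finset.univ : Finset (Fin q)).sup (sigma e), fun d hd => ?_⟩ hd
  obtain ⟨i, hi⟩ := exists_lt_sigma_of_mem_footprint hd
  exact hi.le.trans (Finset.le_sup (Finset.mem_univ i))

theorem exists_sub_mem_errorLocatorIdeal_rho_le (e : Point K q → K) (z : CoordRing K q) :
    ∃ z', z - z' ∈ errorLocatorIdeal e ∧ rho z' ≤ sSup (footprint e) := by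
  induction hz : rho z using Nat.strong_induction_on generalizing z with
  | _ n ih =>
  subst hz
  by_cases z_mem : z ∈ errorLocatorIdeal e
  · exact ⟨0, by rwa [sub_zero], rho_le_iff.2 (zero_mem _)⟩
  have hz0 : z ≠ 0 := fun h => z_mem (h ▸ zero_mem _)
  by_cases hrho : rho z ∈ footprint e
  · exact ⟨z, by rw [sub_self]; exact zero_mem _, le_sSup_footprint hrho⟩
  obtain ⟨f, hf, hf0, rho_eq⟩ : ∃ f ∈ errorLocatorIdeal e, f ≠ 0 ∧ rho f = rho z := by
    by_contra hno
    exact hrho ⟨⟨z, hz0, rfl⟩, hno⟩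
  obtain ⟨u, hu⟩ := exists_sub_smul_mem_orderLT hz0 hf0 rho_eq.symm
  have uf_mem : u • f ∈ errorLocatorIdeal e := Submodule.smul_of_tower_mem _ u hf
  have sub_ne_zero : z - u • f ≠ 0 := fun h => z_mem (sub_eq_zero.1 h ▸ uf_mem)
  obtain ⟨z', hz', hle⟩ := ih _ (by exact_mod_cast rho_lt_of_mem_orderLT sub_ne_zero hu) _ rfl
  refine ⟨z', ?_, hle⟩
  rw [← sub_add_cancel (z - z') (u • f), sub_right_comm]
  exact add_mem hz' uf_mem

end Locator

section Stopping

variable {K : Type*} [Field K] [Fintype K] [DecidableEq K] {q : ℕ} [Fact (IsPrimePow q)]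
  {e : Point K q → K}

theorem syndromePart_eq_zero_of_mem {f : CoordRing K q} (hf : f ∈ errorLocatorIdeal e) {r : ℤ}
    (hr : 0 ≤ r) : syndromePart e r f = 0 := by
  rw [syndromePart_of_nonneg e hr]
  refine Finset.sum_eq_zero fun P _ => ?_
  by_cases hP : e P = 0
  · rw [hP, zero_mul]
  · rw [hf P hP, mul_zero, mul_zero]

theorem mem_errorLocatorIdeal_of_syndromePart (hK : Fintype.card K = q ^ 2) {f : CoordRing K q}
    (h : ∀ z, syndromePart e 0 (z * f) = 0) : f ∈ errorLocatorIdeal e := by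
  intro P hP
  have eq_zero := h (interpolant (Pi.single P 1))
  simp only [syndromePart_of_nonneg e le_rfl, map_mul, evalAt_interpolant hK, Int.toNat_zero,
    pow_zero, one_mul, Pi.single_apply, ite_mul, zero_mul, mul_ite, mul_zero, Finset.sum_ite_eq',
    Finset.mem_univ, if_true] at eq_zero
  exact (mul_eq_zero.1 eq_zero).resolve_left hP

namespace Invariant

variable {m : ℕ} {s : State K q} {k : Fin q → ℕ}

theorem weight_le_sigma (h : Invariant e m s k) (i : Fin q) : weight q (k i) i ≤ sigma e i := by
  obtain ⟨f, hf, n, hn, hsigma⟩ := exists_mem_errorLocatorIdeal_sigma e i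
  rw [hsigma]
  by_contra! hlt
  have hnk := weight_lt_weight.1 hlt
  -- `f • (g_i, ψ_i)` has residual `1` at `k i - 1 - n ≥ 0`, although `f` kills the syndromes.
  have residual_eq := hn.residual_smul (e := e) (v := s.gPair i) (r := k i - 1 - n)
    (by rw [sub_add_cancel]; exact (h.atIndex i).right_residual)
  rw [sub_add_cancel, (h.atIndex i).right_residual_lead, residual_apply,
    polarPart_of_nonneg (by omega), Prod.smul_fst, smul_eq_mul,
    syndromePart_eq_zero_of_mem (Ideal.mul_mem_right _ _ hf) (by omega), sub_zero] at residual_eq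
  exact zero_ne_one residual_eq

theorem f_mem_errorLocatorIdeal (h : Invariant e m s k) (hK : Fintype.card K = q ^ 2)
    {i : Fin q} (hm : weight q (k i) i + sSup (footprint e) < m) :
    s.f i ∈ errorLocatorIdeal e := by
  refine mem_errorLocatorIdeal_of_syndromePart hK fun z => ?_
  obtain ⟨z', hz', hle⟩ := exists_sub_mem_errorLocatorIdeal_rho_le e z
  have residual_eq_zero : residual e 0 (z' • s.fPair i) = 0 :=
    residual_smul_eq_zero (mem_orderLT_rho_add_one z') (h.atIndex i).left_residual (by omega)
  rw [residual_apply, polarPart_of_nonneg le_rfl, sub_zero] at residual_eq_zero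
  rw [← sub_add_cancel z z', add_mul, map_add,
    syndromePart_eq_zero_of_mem (Ideal.mul_mem_right _ _ hz') le_rfl, zero_add]
  exact residual_eq_zero

end Invariant

end Stopping

section ErrorValues

variable {K : Type*} [Field K] [Fintype K] {q : ℕ} [Fact (IsPrimePow q)]

theorem evalAt_ddx_X_pow_card_sub_X_smul (hK : Fintype.card K = q ^ 2) (P : Point K q)
    (φ : CoordRing K q) :
    evalAt P (ddx hK ((X ^ Fintype.card K - X : K[X]) • φ)) = -evalAt P φ := by
  have ddx_x_pow_card : ddx hK (x K q ^ Fintype.card K) = 0 := by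
    rw [Derivation.leibniz_pow, ← Nat.cast_smul_eq_nsmul K, Nat.cast_card_eq_zero, zero_smul]
  have smul_eq : (X ^ Fintype.card K - X : K[X]) • φ = (x K q ^ Fintype.card K - x K q) * φ := by
    rw [sub_smul, ← x_pow_mul, ← pow_one (X : K[X]), ← x_pow_mul, pow_one, sub_mul]
  rw [smul_eq, Derivation.leibniz, map_sub, ddx_x_pow_card, ddx_x]
  simp only [smul_eq_mul, map_add, map_mul, map_sub, map_pow, evalAt_x, FiniteField.pow_card,
    sub_self, zero_mul, zero_add, zero_sub, mul_neg, mul_one, map_neg]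

variable [DecidableEq K] {e : Point K q → K} {f φ : CoordRing K q}

theorem X_pow_card_sub_X_smul_eq (h : ∀ n, (f, φ) ∈ residualGE e n) :
    (X ^ Fintype.card K - X : K[X]) • φ = -(f * interpolant e) := by
  refine eq_of_polarPart fun r c => ?_
  have residual_eq_zero (z : CoordRing K q) : residual e r (z • (f, φ)) = 0 :=
    residual_smul_eq_zero (mem_orderLT_rho_add_one z) (h _) le_rfl
  have polar_eq := residual_eq_zero ((X ^ Fintype.card K - X : K[X]) • y K q ^ (c : ℕ))
  rw [residual_apply, sub_eq_zero, smul_assoc, Prod.smul_fst, Prod.smul_snd, Prod.smul_fst,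
    Prod.smul_snd, smul_eq_mul, smul_eq_mul, syndromePart_X_pow_card_sub_X_smul] at polar_eq
  rw [mul_smul_comm, ← polar_eq, mul_neg, map_neg, mul_assoc]

theorem evalAt_eq_mul_evalAt_ddx (hK : Fintype.card K = q ^ 2) (hf : f ∈ errorLocatorIdeal e)
    (h : ∀ n, (f, φ) ∈ residualGE e n) {P : Point K q} (hP : e P ≠ 0) :
    evalAt P φ = e P * evalAt P (ddx hK f) := by
  rw [← neg_inj, ← evalAt_ddx_X_pow_card_sub_X_smul hK, X_pow_card_sub_X_smul_eq h, map_neg,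
    map_neg, Derivation.leibniz, map_add, smul_eq_mul, smul_eq_mul, map_mul, map_mul, hf P hP,
    zero_mul, zero_add, evalAt_interpolant hK]

end ErrorValues

section FinalState

variable {K : Type*} [Field K] {q : ℕ} [Fact (IsPrimePow q)] [Fintype K] [DecidableEq K]

theorem exists_invariant_finalState (hK : Fintype.card K = q ^ 2) (e : Point K q → K) :
    ∃ m k, Invariant e m (finalState e) k ∧ ∀ i, weight q (k i) i + sSup (footprint e) < m ∧
      weight q (k i) i + (q ^ 2 - q - 1) < m := by
  obtain ⟨k, hk⟩ := exists_invariant hK e (lastIteration e + 1)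
  refine ⟨_, k, hk, fun i => ?_⟩
  have weight_le := hk.weight_le_sigma i
  have sigma_le : sigma e i ≤ (Finset.univ : Finset (Fin q)).sup (sigma e) :=
    Finset.le_sup (Finset.mem_univ i)
  have le_natCast : (q : ℤ) ^ 2 - q - 1 ≤ (q ^ 2 - q - 1 : ℕ) := by
    rw [← Nat.cast_pow]
    generalize q ^ 2 = n
    omega
  unfold lastIteration
  omega

theorem finalState_f_mem_errorLocatorIdeal (hK : Fintype.card K = q ^ 2) (e : Point K q → K)
    (i : Fin q) : (finalState e).f i ∈ errorLocatorIdeal e := by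
  obtain ⟨m, k, hk, hm⟩ := exists_invariant_finalState hK e
  exact hk.f_mem_errorLocatorIdeal hK (hm i).1

theorem finalState_fPair_mem_residualGE (hK : Fintype.card K = q ^ 2) (e : Point K q → K)
    (i : Fin q) (n : ℤ) : (finalState e).fPair i ∈ residualGE e n := by
  obtain ⟨m, k, hk, hm⟩ := exists_invariant_finalState hK e
  intro r c _
  rcases lt_or_ge r 0 with hr | hr
  · refine (hk.atIndex i).left_residual r c ?_
    have := weight_le_of_neg hr c
    linarith [(hm i).2]
  · rw [residual_apply, polarPart_of_nonneg hr, sub_zero]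
    exact syndromePart_eq_zero_of_mem
      (Ideal.mul_mem_left _ _ (finalState_f_mem_errorLocatorIdeal hK e i)) hr

theorem sum_mul_error (hK : Fintype.card K = q ^ 2) (e : Point K q → K) {P : Point K q}
    (hP : e P ≠ 0) :
    (∑ i, evalAt P (ddx hK ((finalState e).f i)) * evalAt P ((finalState e).g i)) * e P = 1 := by
  obtain ⟨m, k, hk, -⟩ := exists_invariant_finalState hK e
  have sum_eq_one := congrArg (evalAt P) hk.sum_pairForm
  rw [map_one, map_sum] at sum_eq_one
  rw [← sum_eq_one, Finset.sum_mul]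
  refine Finset.sum_congr rfl fun i _ => ?_
  have hf := finalState_f_mem_errorLocatorIdeal hK e i
  have φ_eq : evalAt P ((finalState e).φ i) = _ :=
    evalAt_eq_mul_evalAt_ddx hK hf (finalState_fPair_mem_residualGE hK e i) hP
  rw [pairForm_apply, State.fPair, State.gPair, map_sub, map_mul, map_mul, φ_eq, hf P hP]
  ring

end FinalState

end

end Hermitian

theorem mainTheorem4 (q : ℕ) [Fact (IsPrimePow q)] (K : Type*) [Field K] [Fintype K]
    [DecidableEq K] (hK : Fintype.card K = q ^ 2) (e : Hermitian.Point K q → K)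
    (P : Hermitian.Point K q) (hP : e P ≠ 0) :
    e P = (∑ i : Fin q,
      Hermitian.evalAt P (Hermitian.ddx hK ((Hermitian.finalState e).f i)) *
        Hermitian.evalAt P ((Hermitian.finalState e).g i))⁻¹ :=
  eq_inv_of_mul_eq_one_right (Hermitian.sum_mul_error hK e hP)
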